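/- For $n\ge 1$ let $C(S^1)^{(n)}\subseteq M_n(\mathbb C)$ be the space of $n\times n$ complex Toeplitz matrices, i.e. matrices with $T_{i,j}=T_{i+1,j+1}$ whenever both entries exist. A state on $C(S^1)^{(n)}$ is a linear functional $\varphi:C(S^1)^{(n)}\to\mathbb C$ with $\varphi(I)=1$ and $\varphi(T)\ge 0$ for every positive semidefinite Toeplitz matrix $T$. The pure state space $\mathcal P(C(S^1)^{(n)})$ is the set of extreme points of the convex set of states, with the metric \[ d_n(\varphi,\psi)=\sup\{|\varphi(T)-\psi(T)| : T\in C(S^1)^{(n)},\ \|[D_n,T]\|\le 1\},\qquad D_n=\operatorname{diag}(1,\dots,n), \] where $\|\cdot\|$ is the operator norm on $\mathbb C^n$. Let $S^1=\mathbb R/2\pi\mathbb Z$, and let $\mathcal S(C(S^1))$ be the set of states of the C*-algebra $C(S^1)$ of continuous complex-valued functions, i.e. the positive linear functionals $\varphi$ with $\varphi(1)=1$, with the Monge--Kantorovich (Connes) metric \[ d(\varphi,\psi)=\sup\{|\varphi(f)-\psi(f)| : f\in C^\infty(S^1),\ \|[D,f]\|\le 1\},\qquad D=-i\frac{d}{dx},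 \] where $\|[D,f]\|$ is the norm of the commutator $g\mapsto D(fg)-f\,Dg$ as an operator on $L^2(S^1)$ with dense domain $C^\infty(S^1)$. The Gromov--Hausdorff distance $d_{GH}(X,Y)$ of two metric spaces is the infimum, over all metric spaces $Z$ and all isometric embeddings of $X$ and $Y$ into $Z$, of the Hausdorff distance in $Z$ between the images of $X$ and $Y$. **Theorem.** The metric spaces $(\mathcal P(C(S^1)^{(n)}),d_n)$ converge to the metric space $(\mathcal S(C(S^1)),d)$ in the Gromov--Hausdorff sense, i.e. \[ \lim_{n\to\infty} d_{GH}\bigl((\mathcal P(C(S^1)^{(n)}),d_n),\,(\mathcal S(C(S^1)),d)\bigr)=0. \] -/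

import Mathlib

open scoped ComplexOrder ENNReal ContDiff

/-! ### Gromov-Hausdorff distance of arbitrary metric spaces -/

/-- The Gromov-Hausdorff distance: the infimum, over all metric spaces `Z` containing isometric
copies of `X` and `Y`, of the Hausdorff distance between the two copies in `Z`. It takes values in
`[0, ∞]`, and no compactness is assumed. -/
noncomputable def gromovHausdorffEDist (X Y : Type) [MetricSpace X] [MetricSpace Y] : ℝ≥0∞ :=
  ⨅ (Z : Type) (_ : MetricSpace Z) (Φ : X → Z) (Ψ : Y → Z) (_ : Isometry Φ) (_ : Isometry Ψ),
    Metric.hausdorffEDist (Set.range Φ) (Set.range Ψ)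

/-! ### Connes' distance formula -/

/-- `sup { |φ(T) - ψ(T)| : T ∈ L }`, where `L` is the set of all `T` with `‖[D, T]‖ ≤ 1`. -/
noncomputable def connesDist {V : Type*} [AddCommGroup V] [Module ℂ V] (L : Set V)
    (φ ψ : V →ₗ[ℂ] ℂ) : ℝ :=
  sSup ((fun T => ‖φ T - ψ T‖) '' L)

/-- The supremum in Connes' distance formula is a metric as soon as it is finite and separates
the given functionals. -/
noncomputable abbrev connesMetricSpace {V : Type*} [AddCommGroup V] [Module ℂ V] (L : Set V)
    (S : Set (V →ₗ[ℂ] ℂ)) (h0 : (0 : V) ∈ L)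
    (hb : ∀ φ ∈ S, ∀ ψ ∈ S, BddAbove ((fun T => ‖φ T - ψ T‖) '' L))
    (hs : ∀ φ ∈ S, ∀ ψ ∈ S, (∀ T ∈ L, φ T = ψ T) → φ = ψ) : MetricSpace S where
  dist φ ψ := connesDist L φ.1 ψ.1
  dist_self φ := by
    have : (fun T => ‖φ.1 T - φ.1 T‖) '' L = {0} := by
      ext r
      constructor
      · rintro ⟨T, -, rfl⟩
        simp
      · rintro rfl
        exact ⟨0, h0, by simp⟩
    simp only [connesDist, this, csSup_singleton]
  dist_comm φ ψ := by
    simp only [connesDist, norm_sub_rev]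
  dist_triangle φ ψ χ := by
    refine csSup_le ⟨_, 0, h0, rfl⟩ ?_
    rintro _ ⟨T, hT, rfl⟩
    refine (norm_sub_le_norm_sub_add_norm_sub _ (ψ.1 T) _).trans (add_le_add ?_ ?_)
    · exact le_csSup (hb _ φ.2 _ ψ.2) ⟨T, hT, rfl⟩
    · exact le_csSup (hb _ ψ.2 _ χ.2) ⟨T, hT, rfl⟩
  eq_of_dist_eq_zero := by
    intro φ ψ h
    refine Subtype.ext (hs _ φ.2 _ ψ.2 fun T hT => ?_)
    have h1 : ‖φ.1 T - ψ.1 T‖ ≤ connesDist L φ.1 ψ.1 :=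
      le_csSup (hb _ φ.2 _ ψ.2) ⟨T, hT, rfl⟩
    have h2 : connesDist L φ.1 ψ.1 = 0 := h
    rw [h2] at h1
    exact sub_eq_zero.1 (norm_le_zero_iff.1 h1)

/-! ### The Toeplitz operator system -/

/-- The operator system of `n × n` complex Toeplitz matrices: `T i j = T (i + 1) (j + 1)`. -/
def toeplitzSystem (n : ℕ) : Submodule ℂ (Matrix (Fin n) (Fin n) ℂ) where
  carrier := {T | ∀ (i j : ℕ) (hi : i + 1 < n) (hj : j + 1 < n),
    T ⟨i, by omega⟩ ⟨j, by omega⟩ = T ⟨i + 1, hi⟩ ⟨j + 1, hj⟩}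
  add_mem' := by
    intro A B hA hB i j hi hj
    simp only [Matrix.add_apply, hA i j hi hj, hB i j hi hj]
  zero_mem' := by
    intro i j hi hj
    rfl
  smul_mem' := by
    intro c A hA i j hi hj
    simp only [Matrix.smul_apply, hA i j hi hj]

theorem one_mem_toeplitzSystem (n : ℕ) : (1 : Matrix (Fin n) (Fin n) ℂ) ∈ toeplitzSystem n := by
  intro i j hi hj
  simp [Matrix.one_apply]

/-- The states of the Toeplitz operator system: positive linear functionals with `φ(I) = 1`,
positivity of a Toeplitz matrix being positive semidefiniteness. -/
def toeplitzStates (n : ℕ) : Set (toeplitzSystem n →ₗ[ℂ] ℂ) :=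
  {φ | (∀ T : toeplitzSystem n, (T : Matrix (Fin n) (Fin n) ℂ).PosSemidef → 0 ≤ φ T) ∧
    φ ⟨1, one_mem_toeplitzSystem n⟩ = 1}

/-- The truncated Dirac operator `D_n = diag(1, …, n)`. -/
def toeplitzDirac (n : ℕ) : Matrix (Fin n) (Fin n) ℂ :=
  Matrix.diagonal fun i => ((i : ℕ) : ℂ) + 1

/-- The Toeplitz matrices `T` with `‖[D_n, T]‖ ≤ 1`, in the operator norm on `ℂⁿ`. -/
def toeplitzLipBall (n : ℕ) : Set (toeplitzSystem n) :=
  {T | ‖Matrix.toEuclideanCLM (n := Fin n) (𝕜 := ℂ)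
    (toeplitzDirac n * (T : Matrix (Fin n) (Fin n) ℂ) - T * toeplitzDirac n)‖ ≤ 1}

theorem toeplitzSystem_apply_diag {n : ℕ} (T : toeplitzSystem n) (hn : 0 < n) (k : ℕ)
    (hk : k < n) : T.1 ⟨k, hk⟩ ⟨k, hk⟩ = T.1 ⟨0, hn⟩ ⟨0, hn⟩ := by
  induction k with
  | zero => rfl
  | succ k ih => rw [← T.2 k k hk hk, ih]

theorem toeplitzComm_apply {n : ℕ} (T : Matrix (Fin n) (Fin n) ℂ) (i j : Fin n) :
    (toeplitzDirac n * T - T * toeplitzDirac n) i j = ((i : ℂ) - (j : ℂ)) * T i j := by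
  simp only [toeplitzDirac, Matrix.sub_apply, Matrix.diagonal_mul, Matrix.mul_diagonal]
  ring

theorem norm_apply_le_toEuclideanCLM {n : ℕ} (A : Matrix (Fin n) (Fin n) ℂ) (i j : Fin n) :
    ‖A i j‖ ≤ ‖Matrix.toEuclideanCLM (n := Fin n) (𝕜 := ℂ) A‖ := by
  have h1 := (Matrix.toEuclideanCLM (n := Fin n) (𝕜 := ℂ) A).le_opNorm
    (EuclideanSpace.single j 1)
  have h2 := PiLp.norm_apply_le
    (Matrix.toEuclideanCLM (n := Fin n) (𝕜 := ℂ) A (EuclideanSpace.single j 1)) i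
  have h3 : (Matrix.toEuclideanCLM (n := Fin n) (𝕜 := ℂ) A (EuclideanSpace.single j 1)) i
      = A i j := by
    simp [EuclideanSpace.single]
  rw [h3] at h2
  simp only [PiLp.norm_single, norm_one, mul_one] at h1
  exact h2.trans h1

theorem toeplitz_offdiag_le {n : ℕ} {T : toeplitzSystem n} (hT : T ∈ toeplitzLipBall n)
    (i j : Fin n) (hij : i ≠ j) : ‖T.1 i j‖ ≤ 1 := by
  have h1 := (norm_apply_le_toEuclideanCLM _ i j).trans (show _ ≤ (1 : ℝ) from hT)
  rw [toeplitzComm_apply, norm_mul] at h1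
  have h2 : (1 : ℝ) ≤ ‖(i : ℂ) - (j : ℂ)‖ := by
    have h3 : ((i : ℤ) - (j : ℤ)) ≠ 0 := by
      intro h
      exact hij (Fin.ext (by omega))
    have h4 : (1 : ℝ) ≤ |(((i : ℤ) - (j : ℤ) : ℤ) : ℝ)| := by
      exact_mod_cast Int.one_le_abs h3
    have h5 : ((i : ℂ) - (j : ℂ)) = ((((i : ℤ) - (j : ℤ) : ℤ) : ℝ) : ℂ) := by
      push_cast
      rfl
    rwa [h5, Complex.norm_real, Real.norm_eq_abs]
  nlinarith [norm_nonneg (T.1 i j)]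

theorem toeplitz_bddAbove (n : ℕ) (φ : toeplitzSystem n →ₗ[ℂ] ℂ) (hφ : φ ∈ toeplitzStates n)
    (ψ : toeplitzSystem n →ₗ[ℂ] ℂ) (hψ : ψ ∈ toeplitzStates n) :
    BddAbove ((fun T => ‖φ T - ψ T‖) '' toeplitzLipBall n) := by
  rcases Nat.eq_zero_or_pos n with rfl | hn
  · refine ⟨0, ?_⟩
    rintro _ ⟨T, -, rfl⟩
    have : T = 0 := Subtype.ext (by ext i; exact i.elim0)
    simp [this]
  obtain ⟨g, hg⟩ := (φ - ψ).exists_extend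
  refine ⟨∑ i, ∑ j, ‖g (Matrix.single i j 1)‖, ?_⟩
  rintro _ ⟨T, hT, rfl⟩
  set c := T.1 ⟨0, hn⟩ ⟨0, hn⟩ with hc
  set U : toeplitzSystem n := T - c • ⟨1, one_mem_toeplitzSystem n⟩ with hU
  have h1 : φ T - ψ T = g U.1 := by
    have h2 : g U.1 = (φ - ψ) U := by
      rw [← hg]
      rfl
    rw [h2, hU, map_sub, map_smul]
    simp [LinearMap.sub_apply, hφ.2, hψ.2]
  have h3 : ∀ i j, ‖U.1 i j‖ ≤ 1 := by
    intro i j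
    by_cases hij : i = j
    · subst hij
      have : U.1 i i = 0 := by
        have h4 := toeplitzSystem_apply_diag T hn i i.2
        simp only [Fin.eta] at h4
        simp [hU, h4, hc]
      simp [this]
    · have : U.1 i j = T.1 i j := by
        simp [hU, Matrix.one_apply_ne hij]
      rw [this]
      exact toeplitz_offdiag_le hT i j hij
  simp only [h1]
  rw [Matrix.matrix_eq_sum_single U.1, map_sum]
  refine (norm_sum_le _ _).trans (Finset.sum_le_sum fun i _ => ?_)
  rw [map_sum]
  refine (norm_sum_le _ _).trans (Finset.sum_le_sum fun j _ => ?_)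
  have h5 : Matrix.single i j (U.1 i j) = U.1 i j • Matrix.single i j (1 : ℂ) := by
    simp [Matrix.smul_single]
  rw [h5, map_smul, smul_eq_mul, norm_mul]
  exact mul_le_of_le_one_left (norm_nonneg _) (h3 i j)

theorem toeplitz_separates (n : ℕ) (φ ψ : toeplitzSystem n →ₗ[ℂ] ℂ)
    (h : ∀ T ∈ toeplitzLipBall n, φ T = ψ T) : φ = ψ := by
  ext T
  set r := ‖Matrix.toEuclideanCLM (n := Fin n) (𝕜 := ℂ)
    (toeplitzDirac n * (T : Matrix (Fin n) (Fin n) ℂ) - T * toeplitzDirac n)‖ with hr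
  have hr0 : 0 ≤ r := norm_nonneg _
  have hr1 : ((r + 1 : ℝ) : ℂ) ≠ 0 := by
    exact_mod_cast (by positivity : r + 1 ≠ 0)
  have h1 : (((r + 1 : ℝ) : ℂ)⁻¹ • T) ∈ toeplitzLipBall n := by
    have h2 : toeplitzDirac n * ((((r + 1 : ℝ) : ℂ)⁻¹ • T : toeplitzSystem n) :
        Matrix (Fin n) (Fin n) ℂ) - ((((r + 1 : ℝ) : ℂ)⁻¹ • T : toeplitzSystem n) :
        Matrix (Fin n) (Fin n) ℂ) * toeplitzDirac n = ((r + 1 : ℝ) : ℂ)⁻¹ •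
        (toeplitzDirac n * (T : Matrix (Fin n) (Fin n) ℂ) - T * toeplitzDirac n) := by
      simp [smul_sub]
    show ‖_‖ ≤ (1 : ℝ)
    rw [h2, map_smul, norm_smul, ← hr, norm_inv, Complex.norm_real, Real.norm_eq_abs,
      abs_of_pos (by positivity), inv_mul_le_iff₀ (by positivity)]
    linarith
  have h3 := h _ h1
  rw [map_smul, map_smul] at h3
  exact smul_right_injective ℂ (inv_ne_zero hr1) h3

/-- The states of the Toeplitz system with the Connes distance `d_n`. -/
noncomputable instance toeplitzStatesMetricSpace (n : ℕ) : MetricSpace (toeplitzStates n) :=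
  connesMetricSpace (toeplitzLipBall n) (toeplitzStates n)
    (by simp [toeplitzLipBall])
    (fun φ hφ ψ hψ => toeplitz_bddAbove n φ hφ ψ hψ)
    (fun φ _ ψ _ h => toeplitz_separates n φ ψ h)

/-- The pure state space: the extreme points of the state space, with the metric `d_n`. -/
abbrev ToeplitzPureStates (n : ℕ) : Type :=
  {φ : toeplitzStates n // φ.1 ∈ Set.extremePoints ℝ (toeplitzStates n)}

/-! ### The circle -/

instance fact_two_pi_pos : Fact (0 < 2 * Real.pi) := ⟨Real.two_pi_pos⟩

/-- The circle `S¹ = ℝ / 2πℤ`. -/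
abbrev S1 : Type := AddCircle (2 * Real.pi)

/-- Smooth functions on the circle. -/
def CircleSmooth (f : S1 → ℂ) : Prop := ContDiff ℝ ∞ fun t : ℝ => f (t : S1)

/-- The Dirac operator `D = -i d/dx` on functions on the circle. -/
noncomputable def circleDirac (g : S1 → ℂ) (x : S1) : ℂ :=
  -Complex.I * deriv (fun t : ℝ => g (x + (t : S1))) 0

/-- The commutator `[D, f]` applied to `g`, that is `D (f g) - f D g`. -/
noncomputable def circleDiracComm (f g : S1 → ℂ) (x : S1) : ℂ :=
  circleDirac (fun y => f y * g y) x - f x * circleDirac g x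

/-- The `L²(S¹)` operator norm of `[D, f]` as an operator with the dense domain `C^∞(S¹)`. -/
noncomputable def circleDiracCommNorm (f : S1 → ℂ) : ℝ≥0∞ :=
  ⨆ (g : S1 → ℂ) (_ : CircleSmooth g)
    (_ : MeasureTheory.eLpNorm g 2 AddCircle.haarAddCircle ≤ 1),
    MeasureTheory.eLpNorm (circleDiracComm f g) 2 AddCircle.haarAddCircle

/-- The states of the C*-algebra `C(S¹)`: positive linear functionals with `φ(1) = 1`. -/
def circleStates : Set (C(S1, ℂ) →ₗ[ℂ] ℂ) :=
  {φ | (∀ f : C(S1, ℂ), (∀ x, 0 ≤ f x) → 0 ≤ φ f) ∧ φ 1 = 1}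

/-- The smooth functions `f` on the circle with `‖[D, f]‖ ≤ 1`. -/
def circleLipBall : Set C(S1, ℂ) :=
  {f | CircleSmooth f ∧ circleDiracCommNorm f ≤ 1}

theorem circleState_real_le {φ : C(S1, ℂ) →ₗ[ℂ] ℂ} (hφ : φ ∈ circleStates) (u : C(S1, ℂ))
    (r : ℝ) (hu : ∀ x, (u x).im = 0) (hr : ∀ x, |(u x).re| ≤ r) : ‖φ u‖ ≤ r := by
  have h1 : 0 ≤ φ ((r : ℂ) • 1 - u) := by
    refine hφ.1 _ fun x => ?_
    rw [Complex.nonneg_iff]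
    have := abs_le.1 (hr x)
    simp [hu x, this.2]
  have h2 : 0 ≤ φ ((r : ℂ) • 1 + u) := by
    refine hφ.1 _ fun x => ?_
    rw [Complex.nonneg_iff]
    have := abs_le.1 (hr x)
    simp only [ContinuousMap.add_apply, ContinuousMap.smul_apply, ContinuousMap.one_apply,
      smul_eq_mul, mul_one, Complex.add_re, Complex.ofReal_re, Complex.add_im, Complex.ofReal_im,
      hu x, add_zero, and_true]
    linarith
  rw [map_sub, map_smul, hφ.2, Complex.nonneg_iff] at h1
  rw [map_add, map_smul, hφ.2, Complex.nonneg_iff] at h2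
  simp at h1 h2
  have h3 : φ u = ((φ u).re : ℂ) := Complex.ext rfl (by simp [← h2.2])
  rw [h3, Complex.norm_real, Real.norm_eq_abs, abs_le]
  constructor <;> linarith [h1.1, h2.1]

theorem circleState_norm_le {φ : C(S1, ℂ) →ₗ[ℂ] ℂ} (hφ : φ ∈ circleStates) (f : C(S1, ℂ))
    (r : ℝ) (hr : ∀ x, ‖f x‖ ≤ r) : ‖φ f‖ ≤ 2 * r := by
  set u : C(S1, ℂ) := ⟨fun x => ((f x).re : ℂ), by fun_prop⟩ with hu
  set v : C(S1, ℂ) := ⟨fun x => ((f x).im : ℂ), by fun_prop⟩ with hv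
  have h1 : f = u + Complex.I • v := by
    ext x
    simp [hu, hv, mul_comm Complex.I, Complex.re_add_im]
  have h2 : ‖φ u‖ ≤ r := circleState_real_le hφ u r (fun x => by simp [hu])
    fun x => by simpa [hu] using (Complex.abs_re_le_norm _).trans (hr x)
  have h3 : ‖φ v‖ ≤ r := circleState_real_le hφ v r (fun x => by simp [hv])
    fun x => by simpa [hv] using (Complex.abs_im_le_norm _).trans (hr x)
  rw [h1, map_add, map_smul]
  refine (norm_add_le _ _).trans ?_
  simp only [norm_smul, Complex.norm_I, one_mul]
  linarith

theorem circleDirac_coe (g : S1 → ℂ) (t : ℝ) :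
    circleDirac g (t : S1) = -Complex.I * deriv (fun s : ℝ => g (s : S1)) t := by
  have h := deriv_comp_const_add (fun s : ℝ => g (s : S1)) t 0
  simp only [add_zero, AddCircle.coe_add] at h
  rw [circleDirac, ← h]

theorem circleDirac_one : circleDirac (fun _ => 1) = 0 := by
  ext x
  simp [circleDirac]

theorem circleSmooth_deriv_continuous {f : S1 → ℂ} (hf : CircleSmooth f) :
    Continuous (circleDirac f) := by
  have h1 : Continuous fun t : ℝ => circleDirac f (t : S1) := by
    simp only [circleDirac_coe]
    exact continuous_const.mul (hf.continuous_deriv (by simp))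
  exact (QuotientAddGroup.isQuotientMap_mk _).continuous_iff.2 h1

theorem circleDiracComm_eq {f g : S1 → ℂ} (hf : CircleSmooth f) (hg : CircleSmooth g) (x : S1) :
    circleDiracComm f g x = circleDirac f x * g x := by
  induction x using QuotientAddGroup.induction_on with
  | H t =>
    have h1 : DifferentiableAt ℝ (fun s : ℝ => f (s : S1)) t :=
      hf.differentiable (by simp) t
    have h2 : DifferentiableAt ℝ (fun s : ℝ => g (s : S1)) t :=
      hg.differentiable (by simp) t
    have h3 := circleDirac_coe (fun y => f y * g y) t
    rw [deriv_fun_mul h1 h2] at h3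
    have h4 := circleDirac_coe f t
    have h5 := circleDirac_coe g t
    change circleDirac (fun y => f y * g y) (t : S1) - f (t : S1) * circleDirac g (t : S1) =
      circleDirac f (t : S1) * g (t : S1)
    rw [h3, h4, h5]
    ring

theorem circleLipBall_osc {f : C(S1, ℂ)} (hf : f ∈ circleLipBall) (x : S1) :
    ‖f x - f 0‖ ≤ 2 * Real.pi := by
  have hc := circleSmooth_deriv_continuous hf.1
  have h1 : MeasureTheory.eLpNorm (circleDirac f) 2 AddCircle.haarAddCircle ≤ 1 := by
    have h2 := hf.2
    have h3 : circleDiracComm f (fun _ => 1) = circleDirac f := by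
      ext y
      simp [circleDiracComm, circleDirac_one]
    rw [← h3]
    refine le_trans ?_ h2
    refine le_iSup_of_le (fun _ => 1) (le_iSup_of_le contDiff_const (le_iSup_of_le ?_ le_rfl))
    rw [MeasureTheory.eLpNorm_const _ (by simp) (NeZero.ne _)]
    simp
  have h4 : MeasureTheory.eLpNorm (circleDirac f) 1 AddCircle.haarAddCircle ≤ 1 :=
    (MeasureTheory.eLpNorm_le_eLpNorm_of_exponent_le (by norm_num)
      hc.aestronglyMeasurable).trans h1
  have h5 : ∫ y : S1, ‖circleDirac f y‖ ∂AddCircle.haarAddCircle ≤ 1 := by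
    rw [MeasureTheory.integral_norm_eq_lintegral_enorm hc.aestronglyMeasurable,
      ← MeasureTheory.eLpNorm_one_eq_lintegral_enorm]
    exact ENNReal.toReal_le_of_le_ofReal zero_le_one (by simpa using h4)
  have h6 : ∫ t in (0 : ℝ)..(0 + 2 * Real.pi), ‖circleDirac f (t : S1)‖ ≤ 2 * Real.pi := by
    rw [AddCircle.intervalIntegral_preimage (2 * Real.pi) 0 (fun y => ‖circleDirac f y‖),
      AddCircle.volume_eq_smul_haarAddCircle, MeasureTheory.integral_smul_measure,
      ENNReal.toReal_ofReal Real.two_pi_pos.le, smul_eq_mul]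
    exact mul_le_of_le_one_right Real.two_pi_pos.le h5
  have h7 : ∀ t : ℝ, ‖deriv (fun s : ℝ => f (s : S1)) t‖ = ‖circleDirac f (t : S1)‖ := by
    intro t
    rw [circleDirac_coe]
    simp
  obtain ⟨t, ht, rfl⟩ : ∃ t ∈ Set.Ico (0 : ℝ) (0 + 2 * Real.pi), (t : S1) = x := by
    have := (AddCircle.coe_image_Ico_eq (2 * Real.pi) 0).symm ▸ Set.mem_univ x
    exact this
  have hdc : Continuous fun s : ℝ => deriv (fun s : ℝ => f (s : S1)) s :=
    hf.1.continuous_deriv (by simp)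
  have h8 : ∫ s in (0 : ℝ)..t, deriv (fun s : ℝ => f (s : S1)) s = f (t : S1) - f 0 := by
    rw [intervalIntegral.integral_deriv_eq_sub
      (fun s _ => hf.1.differentiable (by simp) s) (hdc.intervalIntegrable _ _)]
    simp
  rw [← h8]
  refine (intervalIntegral.norm_integral_le_integral_norm ht.1).trans ?_
  refine le_trans ?_ h6
  simp only [← h7]
  exact intervalIntegral.integral_mono_interval le_rfl ht.1 ht.2.le
    (Filter.Eventually.of_forall fun _ => norm_nonneg _) (hdc.norm.intervalIntegrable _ _)

theorem circle_bddAbove (φ : C(S1, ℂ) →ₗ[ℂ] ℂ) (hφ : φ ∈ circleStates)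
    (ψ : C(S1, ℂ) →ₗ[ℂ] ℂ) (hψ : ψ ∈ circleStates) :
    BddAbove ((fun f => ‖φ f - ψ f‖) '' circleLipBall) := by
  refine ⟨2 * (2 * Real.pi) + 2 * (2 * Real.pi), ?_⟩
  rintro _ ⟨f, hf, rfl⟩
  set g : C(S1, ℂ) := f - f 0 • 1 with hg
  have h1 : ∀ x, ‖g x‖ ≤ 2 * Real.pi := by
    intro x
    simpa [hg] using circleLipBall_osc hf x
  have h2 : φ f - ψ f = φ g - ψ g := by
    simp [hg, hφ.2, hψ.2]
  simp only [h2]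
  exact (norm_sub_le _ _).trans
    (add_le_add (circleState_norm_le hφ g _ h1) (circleState_norm_le hψ g _ h1))

theorem circleSmooth_smul_mem {f : C(S1, ℂ)} (hf : CircleSmooth f) :
    ∃ r : ℝ, 0 < r ∧ (r : ℂ) • f ∈ circleLipBall := by
  have hc := circleSmooth_deriv_continuous hf
  obtain ⟨C, hC⟩ := isCompact_univ.exists_bound_of_continuousOn hc.continuousOn
  have hC0 : 0 ≤ C := (norm_nonneg _).trans (hC 0 trivial)
  refine ⟨(C + 1)⁻¹, by positivity, ?_, ?_⟩
  · exact contDiff_const.mul hf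
  · refine iSup_le fun g => iSup_le fun hg => iSup_le fun hg1 => ?_
    refine le_trans (MeasureTheory.eLpNorm_mono fun x => ?_) hg1
    have h1 : CircleSmooth (((((C + 1)⁻¹ : ℝ) : ℂ) • f : C(S1, ℂ)) : S1 → ℂ) :=
      contDiff_const.mul hf
    rw [circleDiracComm_eq h1 hg, norm_mul]
    refine mul_le_of_le_one_left (norm_nonneg _) ?_
    have h2 : circleDirac (((((C + 1)⁻¹ : ℝ) : ℂ) • f : C(S1, ℂ)) : S1 → ℂ) x =
        (((C + 1)⁻¹ : ℝ) : ℂ) * circleDirac f x := by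
      simp only [circleDirac, ContinuousMap.coe_smul, Pi.smul_apply, smul_eq_mul,
        deriv_const_mul_field]
      ring
    rw [h2, norm_mul, Complex.norm_real, Real.norm_eq_abs, abs_of_pos (by positivity),
      inv_mul_le_iff₀ (by positivity)]
    linarith [hC x trivial]

theorem circleSmooth_fourier (k : ℤ) : CircleSmooth (fourier k : C(S1, ℂ)) := by
  unfold CircleSmooth
  simp only [fourier_coe_apply]
  exact ((contDiff_const.mul Complex.ofRealCLM.contDiff).div_const _).cexp

theorem circle_separates (φ : C(S1, ℂ) →ₗ[ℂ] ℂ) (hφ : φ ∈ circleStates)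
    (ψ : C(S1, ℂ) →ₗ[ℂ] ℂ) (hψ : ψ ∈ circleStates)
    (h : ∀ f ∈ circleLipBall, φ f = ψ f) : φ = ψ := by
  have hcont : ∀ χ ∈ circleStates, Continuous χ := fun χ hχ =>
    (LinearMap.mkContinuous χ 2 fun f =>
      circleState_norm_le hχ f _ fun x => f.norm_coe_le_norm x).continuous
  have h1 : ∀ k : ℤ, φ (fourier k) = ψ (fourier k) := by
    intro k
    obtain ⟨r, hr, hm⟩ := circleSmooth_smul_mem (circleSmooth_fourier k)
    have h2 := h _ hm
    rw [map_smul, map_smul] at h2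
    exact smul_right_injective ℂ (Complex.ofReal_ne_zero.2 hr.ne') h2
  have h3 : Submodule.span ℂ (Set.range (fourier (T := 2 * Real.pi))) ≤
      LinearMap.eqLocus φ ψ := by
    rw [Submodule.span_le]
    rintro _ ⟨k, rfl⟩
    exact h1 k
  ext f
  have h4 : f ∈ (Submodule.span ℂ (Set.range (fourier (T := 2 * Real.pi)))).topologicalClosure := by
    rw [span_fourier_closure_eq_top]
    trivial
  exact closure_minimal h3 (isClosed_eq (hcont φ hφ) (hcont ψ hψ)) h4

/-- The state space of `C(S¹)` with the Connes (Monge-Kantorovich) distance `d`. -/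
noncomputable instance circleStatesMetricSpace : MetricSpace circleStates :=
  connesMetricSpace circleLipBall circleStates
    (by
      refine ⟨contDiff_const, ?_⟩
      refine iSup_le fun g => iSup_le fun hg => iSup_le fun hg1 => ?_
      have h : circleDiracComm ((0 : C(S1, ℂ)) : S1 → ℂ) g = 0 := by
        ext x
        simp [circleDiracComm, circleDirac]
      rw [h]
      simp)
    circle_bddAbove circle_separates

/-! Compressing the multiplication operator by `f` to `n` consecutive Fourier modes gives a Toeplitz
matrix. Dually, every state of the Toeplitz system pulls back to a state of `C(S¹)`. The theorem
follows once this pullback is shown to be almost isometric, and almost surjective already on pure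
states.

Almost isometric: compression commutes with taking commutators with the Dirac operators, so it
preserves the Lipschitz balls (`compression_mem_toeplitzLipBall`). In the other direction the symbol
map sends the Toeplitz ball into the circle ball (`matrixSymbol_mem_circleLipBall`). Symbol followed
by compression multiplies the `k`-th diagonal by `1 - |k|/n`, and the resulting error is `[D_n,
T]/n` up to the signs of the entries. Its Hilbert-Schmidt norm is at most `1/√n`, so distances
change by at most `4/√n` (`abs_dist_sub_dist_pullbackState_le`).

Almost surjective: a vector `p`, read as a polynomial of degree `n - 1`, gives the state with
density `|p|²`. If all zeros of `p` lie on the unit circle this state is extreme. Indeed, a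
functional dominated by it yields a polynomial of degree at most `2(n - 1)` that is bounded on the
circle by a multiple of `|p|²`, hence divisible by `p²`, hence a scalar multiple of it. Only this
direction of the description of pure states is needed.

Such densities can imitate any state at low frequencies. A state `ψ` is first replaced by weights on
a grid, and these by the density `|Q|²` of a sum of frequency-separated Dirichlet kernels
(`integral_fourier_mul_dirichletSum`). Reflecting zeros of `Q` in the circle gives `q` and `r` with
`|q| = |r| = |Q|` there, and `(z^κ q + r)/√2` has all its zeros on the circle. Its squared modulus
is `|Q|²` plus terms oscillating at frequencies near `±κ`, invisible to low modes
(`exists_polynomial_roots_on_circle`).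

Agreement of low modes suffices uniformly over the Lipschitz ball, because there `∑ k² |f̂(k)|² ≤ 1`
(`norm_sub_le_of_fourier`). -/

/-! ### Gromov-Hausdorff comparison by gluing -/

/-- Two metric spaces related by an approximately isometric map with approximately dense range
are close in the Gromov-Hausdorff sense. -/
theorem gromovHausdorffEDist_le_of_approx {X Y : Type} [MetricSpace X] [MetricSpace Y]
    [Nonempty X] (F : X → Y) {ε δ : ℝ} (hε : 0 < ε) (hδ : 0 ≤ δ)
    (hF : ∀ p q, |dist p q - dist (F p) (F q)| ≤ 2 * ε) (hd : ∀ y, ∃ x, dist y (F x) ≤ δ) :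
    gromovHausdorffEDist X Y ≤ ENNReal.ofReal (ε + δ) := by
  -- Glue along the graph of `F`, with `x` and `F x` at distance `ε`; a distortion of at most `2 *
  -- ε` is what the triangle inequality for two crossings allows.
  let m : MetricSpace (X ⊕ Y) := Metric.glueMetricApprox id F ε hε hF
  have hl : Isometry (Sum.inl : X → X ⊕ Y) := Isometry.of_dist_eq fun _ _ => rfl
  have hr : Isometry (Sum.inr : Y → X ⊕ Y) := Isometry.of_dist_eq fun _ _ => rfl
  have hg : ∀ x, dist (Sum.inl x : X ⊕ Y) (Sum.inr (F x)) = ε :=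
    fun x => Metric.glueDist_glued_points id F ε x
  refine iInf_le_of_le (X ⊕ Y) (iInf_le_of_le m (iInf_le_of_le Sum.inl (iInf_le_of_le Sum.inr
    (iInf_le_of_le hl (iInf_le_of_le hr ?_)))))
  refine Metric.hausdorffEDist_le_of_mem_edist ?_ ?_
  · rintro _ ⟨x, rfl⟩
    refine ⟨_, ⟨F x, rfl⟩, ?_⟩
    rw [edist_dist]
    exact ENNReal.ofReal_le_ofReal (by rw [hg]; linarith)
  · rintro _ ⟨y, rfl⟩
    obtain ⟨x, hx⟩ := hd y
    refine ⟨_, ⟨x, rfl⟩, ?_⟩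
    rw [edist_dist]
    refine ENNReal.ofReal_le_ofReal ?_
    have h1 := dist_triangle (Sum.inr y : X ⊕ Y) (Sum.inr (F x)) (Sum.inl x)
    have h2 : dist (Sum.inr y : X ⊕ Y) (Sum.inr (F x)) = dist y (F x) := rfl
    rw [dist_comm (Sum.inr (F x) : X ⊕ Y), hg, h2] at h1
    linarith

/-! ### Fourier analysis on the circle -/

local notation "haarS1" => (AddCircle.haarAddCircle : MeasureTheory.Measure S1)

theorem circle_integrable {f : S1 → ℂ} (hf : Continuous f) : MeasureTheory.Integrable f haarS1 :=
  hf.integrable_of_hasCompactSupport (HasCompactSupport.of_compactSpace f)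

theorem integral_fourier (k : ℤ) :
    ∫ x : S1, fourier k x ∂haarS1 = if k = 0 then 1 else 0 := by
  have h := congrFun (fourierCoeff_fourier (T := 2 * Real.pi) k) 0
  simp only [fourierCoeff, neg_zero, fourier_zero, one_smul] at h
  rw [h, Pi.single_apply]
  simp [eq_comm]

theorem hasSum_sq_fourierCoeff_of_continuous {f : S1 → ℂ} (hf : Continuous f) :
    HasSum (fun k => ‖fourierCoeff f k‖ ^ 2) (∫ x, ‖f x‖ ^ 2 ∂haarS1) := by
  let F : C(S1, ℂ) := ⟨f, hf⟩
  have h := hasSum_sq_fourierCoeff (ContinuousMap.toLp 2 haarS1 ℂ F)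
  have h1 : ⇑(ContinuousMap.toLp 2 haarS1 ℂ F) =ᵐ[haarS1] f := ContinuousMap.coeFn_toLp haarS1 F
  have h2 : ∫ x, ‖(ContinuousMap.toLp 2 haarS1 ℂ F) x‖ ^ 2 ∂haarS1 = ∫ x, ‖f x‖ ^ 2 ∂haarS1 :=
    MeasureTheory.integral_congr_ae (h1.mono fun x hx => by simp only [hx])
  rw [h2] at h
  simpa only [fourierCoeff_congr_ae h1] using h

theorem circle_eLpNorm_two {f : S1 → ℂ} (hf : Continuous f) :
    MeasureTheory.eLpNorm f 2 haarS1 = ENNReal.ofReal (Real.sqrt (∫ x, ‖f x‖ ^ 2 ∂haarS1)) := by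
  have hm : MeasureTheory.MemLp f 2 haarS1 :=
    hf.memLp_of_hasCompactSupport (HasCompactSupport.of_compactSpace f)
  rw [hm.eLpNorm_eq_integral_rpow_norm (by norm_num) (by norm_num)]
  simp [Real.sqrt_eq_rpow]

theorem circle_eLpNorm_two_le_one_iff {f : S1 → ℂ} (hf : Continuous f) :
    MeasureTheory.eLpNorm f 2 haarS1 ≤ 1 ↔ ∫ x, ‖f x‖ ^ 2 ∂haarS1 ≤ 1 := by
  rw [circle_eLpNorm_two hf, ENNReal.ofReal_le_one, Real.sqrt_le_iff]
  simp

theorem CircleSmooth.continuous {f : S1 → ℂ} (hf : CircleSmooth f) : Continuous f :=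
  (QuotientAddGroup.isQuotientMap_mk _).continuous_iff.2 (ContDiff.continuous hf)

theorem integral_circleDirac {f : S1 → ℂ} (hf : CircleSmooth f) :
    ∫ x, circleDirac f x ∂haarS1 = 0 := by
  rw [AddCircle.integral_haarAddCircle,
    ← AddCircle.intervalIntegral_preimage (2 * Real.pi) 0 (circleDirac f)]
  simp only [circleDirac_coe, intervalIntegral.integral_const_mul]
  rw [intervalIntegral.integral_deriv_eq_sub
      (fun s _ => hf.differentiable (by simp) s)
      ((hf.continuous_deriv (by simp)).intervalIntegrable _ _)]
  have : ((0 + 2 * Real.pi : ℝ) : S1) = ((0 : ℝ) : S1) := by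
    rw [zero_add, AddCircle.coe_period]; rfl
  rw [this]
  simp

theorem circleDirac_fourier (k : ℤ) (x : S1) :
    circleDirac (fourier k : C(S1, ℂ)) x = k * fourier k x := by
  induction x using QuotientAddGroup.induction_on with
  | H t =>
    have h := circleDirac_coe (fourier k : C(S1, ℂ)) t
    refine h.trans ?_
    rw [(hasDerivAt_fourier (2 * Real.pi) k t).deriv]
    have : (Real.pi : ℂ) ≠ 0 := by exact_mod_cast Real.pi_ne_zero
    push_cast
    field_simp
    linear_combination (-(k : ℂ)) * Complex.I_sq

/-- Integration by parts: the integral of `D (f e_{-k})` vanishes, and the Leibniz rule splits it.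
-/
theorem fourierCoeff_circleDirac {f : S1 → ℂ} (hf : CircleSmooth f) (k : ℤ) :
    fourierCoeff (circleDirac f) k = k * fourierCoeff f k := by
  have hk := circleSmooth_fourier (-k)
  have h0 := integral_circleDirac (f := fun y => f y * fourier (-k) y) (hf.mul hk)
  have h1 : ∀ x, circleDirac (fun y => f y * fourier (-k) y) x =
      fourier (-k) x • circleDirac f x - k * (fourier (-k) x • f x) := by
    intro x
    have h2 := circleDiracComm_eq hf hk x
    rw [circleDiracComm, sub_eq_iff_eq_add, circleDirac_fourier] at h2
    rw [h2]
    push_cast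
    simp only [smul_eq_mul]
    ring
  simp only [h1] at h0
  have hc := (circleSmooth_deriv_continuous hf)
  have hc' := hf.continuous
  rw [MeasureTheory.integral_sub (circle_integrable (by fun_prop))
    (circle_integrable (by fun_prop)), MeasureTheory.integral_const_mul, sub_eq_zero] at h0
  exact h0

theorem circleLipBall_integral_le {f g : S1 → ℂ} (hf : CircleSmooth f)
    (h : circleDiracCommNorm f ≤ 1) (hg : CircleSmooth g) (hg1 : ∫ x, ‖g x‖ ^ 2 ∂haarS1 ≤ 1) :
    ∫ x, ‖circleDirac f x * g x‖ ^ 2 ∂haarS1 ≤ 1 := by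
  rw [← circle_eLpNorm_two_le_one_iff hg.continuous] at hg1
  refine (circle_eLpNorm_two_le_one_iff
    ((circleSmooth_deriv_continuous hf).mul hg.continuous)).1 ?_
  have h1 : circleDiracComm f g = fun x => circleDirac f x * g x :=
    funext (circleDiracComm_eq hf hg)
  change MeasureTheory.eLpNorm (fun x => circleDirac f x * g x) 2 haarS1 ≤ 1
  rw [← h1]
  refine le_trans ?_ h
  exact le_iSup_of_le g (le_iSup_of_le hg (le_iSup_of_le hg1 le_rfl))

/-- Weighted square summability of the Fourier coefficients of Lipschitz functions. -/
theorem circleLipBall_fourierCoeff {f : C(S1, ℂ)} (hf : f ∈ circleLipBall) :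
    ∃ A ≤ 1, HasSum (fun k : ℤ => (|(k : ℝ)| * ‖fourierCoeff f k‖) ^ 2) A := by
  refine ⟨∫ x, ‖circleDirac f x‖ ^ 2 ∂haarS1, ?_, ?_⟩
  rotate_left
  · have h := hasSum_sq_fourierCoeff_of_continuous (circleSmooth_deriv_continuous hf.1)
    simp only [fourierCoeff_circleDirac hf.1, norm_mul, Complex.norm_intCast] at h
    exact h
  · have := circleLipBall_integral_le hf.1 hf.2 (g := fun _ => 1) contDiff_const (by simp)
    simpa using this

/-- `[D, f]` is multiplication by `D f`, so a sup norm bound on `D f` bounds the operator. -/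
theorem mem_circleLipBall_of_norm_le {f : C(S1, ℂ)} (hf : CircleSmooth f)
    (h : ∀ x, ‖circleDirac f x‖ ≤ 1) : f ∈ circleLipBall := by
  refine ⟨hf, iSup_le fun g => iSup_le fun hg => iSup_le fun hg1 => ?_⟩
  refine le_trans (MeasureTheory.eLpNorm_mono fun x => ?_) hg1
  rw [circleDiracComm_eq hf hg, norm_mul]
  exact mul_le_of_le_one_left (norm_nonneg _) (h x)

/-! ### Toeplitz matrices -/

theorem toeplitzSystem_apply_eq_aux {n : ℕ} (T : toeplitzSystem n) (m : ℕ) : ∀ (a b : ℕ)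
    (ha : a + m < n) (hb : b + m < n),
    T.1 ⟨a + m, ha⟩ ⟨b + m, hb⟩ = T.1 ⟨a, by omega⟩ ⟨b, by omega⟩ := by
  induction m with
  | zero => intro a b ha hb; rfl
  | succ m ih =>
    intro a b ha hb
    rw [← ih a b (by omega) (by omega)]
    exact (T.2 (a + m) (b + m) (by omega) (by omega)).symm

theorem toeplitzSystem_apply_eq {n : ℕ} (T : toeplitzSystem n) (a b c d : Fin n)
    (h : (a : ℤ) - b = (c : ℤ) - d) : T.1 a b = T.1 c d := by
  have key : ∀ a b c d : Fin n, (a : ℤ) - b = (c : ℤ) - d → a ≤ c → T.1 a b = T.1 c d := by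
    rintro ⟨a, ha⟩ ⟨b, hb⟩ ⟨c, hc⟩ ⟨d, hd⟩ h hac
    obtain ⟨m, rfl⟩ := Nat.exists_eq_add_of_le (show a ≤ c from hac)
    obtain rfl : d = b + m := by simp only at h; push_cast at h; omega
    exact (toeplitzSystem_apply_eq_aux T m a b hc hd).symm
  rcases le_total a c with h1 | h1
  · exact key a b c d h h1
  · exact (key c d a b h.symm h1).symm

/-- The Toeplitz matrix with entries `t (a - b)`. -/
def toeplitzOf (n : ℕ) (t : ℤ → ℂ) : toeplitzSystem n :=
  ⟨Matrix.of fun a b => t ((a : ℤ) - b), by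
    intro i j hi hj
    simp⟩

@[simp]
theorem toeplitzOf_apply (n : ℕ) (t : ℤ → ℂ) (a b : Fin n) :
    (toeplitzOf n t).1 a b = t ((a : ℤ) - b) := rfl

/-- The adjoint of a Toeplitz matrix. -/
def toeplitzAdjoint {n : ℕ} (T : toeplitzSystem n) : toeplitzSystem n :=
  ⟨T.1.conjTranspose, by
    intro i j hi hj
    simp only [Matrix.conjTranspose_apply, T.2 j i hj hi]⟩

/-- The number of entries on the `k`-th diagonal, which is the source of all the Fejér weights
below. Truncated subtraction gives the right value `0` for empty diagonals. -/
theorem sum_range_sub_eq (n : ℕ) (k : ℤ) :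
    ∑ c ∈ Finset.range n, ∑ d ∈ Finset.range n, (if (c : ℤ) - d = k then (1 : ℂ) else 0) =
      ((n - k.natAbs : ℕ) : ℂ) := by
  have h1 : ∀ c ∈ Finset.range n,
      ∑ d ∈ Finset.range n, (if (c : ℤ) - d = k then (1 : ℂ) else 0) =
      -- Row `c` meets the diagonal exactly when `0 ≤ c - k < n`; the two `toNat` terms treat both
      -- signs of `k` at once.
      if c ∈ Finset.Ico k.toNat (n - (-k).toNat) then 1 else 0 := by
    intro c hc
    rw [Finset.mem_range] at hc
    split_ifs with h
    · rw [Finset.mem_Ico] at h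
      rw [Finset.sum_eq_single (c - k).toNat]
      · rw [if_pos (by omega)]
      · intro d _ hd
        rw [if_neg (by omega)]
      · intro h'
        rw [Finset.mem_range] at h'
        omega
    · refine Finset.sum_eq_zero fun d hd => if_neg fun h' => h ?_
      rw [Finset.mem_range] at hd
      rw [Finset.mem_Ico]
      omega
  rw [Finset.sum_congr rfl h1, Finset.sum_ite_mem, Finset.sum_const, nsmul_eq_mul, mul_one,
    Finset.inter_eq_right.2, Nat.card_Ico]
  · congr 1
    omega
  · intro c hc
    rw [Finset.mem_Ico] at hc
    rw [Finset.mem_range]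
    omega

theorem sum_fin_sub_eq (n : ℕ) (k : ℤ) :
    ∑ c : Fin n, ∑ d : Fin n, (if (c : ℤ) - d = k then (1 : ℂ) else 0) =
      ((n - k.natAbs : ℕ) : ℂ) := by
  rw [← sum_range_sub_eq, Finset.sum_range]
  simp only [Finset.sum_range]

theorem quadForm_conjTranspose {n : ℕ} (A : Matrix (Fin n) (Fin n) ℂ) (v : Fin n → ℂ) :
    star v ⬝ᵥ A.conjTranspose.mulVec v = star (star v ⬝ᵥ A.mulVec v) := by
  rw [Matrix.star_dotProduct, Matrix.star_mulVec, Matrix.conjTranspose_conjTranspose,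
    ← Matrix.dotProduct_mulVec]

/-- Both `c I + H` and `c I - H` are positive semidefinite, and a state is nonnegative on them. -/
theorem toeplitzState_real_le {n : ℕ} {φ : toeplitzSystem n →ₗ[ℂ] ℂ} (hφ : φ ∈ toeplitzStates n)
    (H : toeplitzSystem n) (hH : H.1.IsHermitian) (c : ℝ)
    (hc : ∀ v : Fin n → ℂ, ‖star v ⬝ᵥ H.1.mulVec v‖ ≤ c * ∑ i, ‖v i‖ ^ 2) : ‖φ H‖ ≤ c := by
  set J : toeplitzSystem n := ⟨1, one_mem_toeplitzSystem n⟩ with hJ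
  have hre : ∀ v : Fin n → ℂ, star v ⬝ᵥ H.1.mulVec v = ((star v ⬝ᵥ H.1.mulVec v).re : ℂ) := by
    intro v
    have := quadForm_conjTranspose H.1 v
    rw [hH.eq] at this
    exact (Complex.conj_eq_iff_re.1 this.symm).symm
  have hone : ∀ v : Fin n → ℂ, star v ⬝ᵥ v = ((∑ i, ‖v i‖ ^ 2 : ℝ) : ℂ) := by
    intro v
    simp [dotProduct, Complex.conj_mul']
  have hpos : ∀ ε : ℝ, (ε = 1 ∨ ε = -1) → 0 ≤ φ ((c : ℂ) • J + (ε : ℂ) • H) := by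
    intro ε hε
    refine hφ.1 _ (Matrix.posSemidef_iff_dotProduct_mulVec.2 ⟨?_, fun v => ?_⟩)
    · refine Matrix.IsHermitian.add ?_ ?_
      · simp [Matrix.IsHermitian, hJ, Matrix.conjTranspose_smul]
      · simp [Matrix.IsHermitian, Matrix.conjTranspose_smul, hH.eq]
    · have h1 : star v ⬝ᵥ ((c : ℂ) • J + (ε : ℂ) • H : toeplitzSystem n).1.mulVec v =
          ((c * ∑ i, ‖v i‖ ^ 2 + ε * (star v ⬝ᵥ H.1.mulVec v).re : ℝ) : ℂ) := by
        push_cast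
        rw [← hre]
        simp [hJ, Matrix.add_mulVec, Matrix.smul_mulVec, dotProduct_add, dotProduct_smul, hone]
      rw [h1, Complex.zero_le_real]
      have h2 := abs_le.1 ((Complex.abs_re_le_norm _).trans (hc v))
      rcases hε with rfl | rfl <;> linarith [h2.1, h2.2]
  have h1 := hpos 1 (Or.inl rfl)
  have h2 := hpos (-1) (Or.inr rfl)
  simp only [map_add, map_smul, hJ, hφ.2, Complex.nonneg_iff] at h1 h2
  simp at h1 h2
  have h3 : φ H = ((φ H).re : ℂ) := Complex.ext rfl (by simp [← h1.2])
  rw [h3, Complex.norm_real, Real.norm_eq_abs, abs_le]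
  constructor <;> linarith [h1.1, h2.1]

/-- Split `X` into Hermitian and skew-Hermitian parts, which are again Toeplitz. The factor `2` is
crude but harmless, as only the decay in `n` matters. -/
theorem toeplitzState_norm_le {n : ℕ} {φ : toeplitzSystem n →ₗ[ℂ] ℂ} (hφ : φ ∈ toeplitzStates n)
    (X : toeplitzSystem n) (c : ℝ)
    (hc : ∀ v : Fin n → ℂ, ‖star v ⬝ᵥ X.1.mulVec v‖ ≤ c * ∑ i, ‖v i‖ ^ 2) : ‖φ X‖ ≤ 2 * c := by
  set H : toeplitzSystem n := (1 / 2 : ℂ) • (X + toeplitzAdjoint X) with hHdef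
  set K : toeplitzSystem n := (-(Complex.I / 2) : ℂ) • (X - toeplitzAdjoint X) with hKdef
  have hX : X = H + Complex.I • K := by
    rw [hHdef, hKdef, smul_smul]
    have : Complex.I * -(Complex.I / 2) = 1 / 2 := by linear_combination (-1 / 2) * Complex.I_sq
    rw [this, ← smul_add, add_add_sub_cancel, ← two_smul ℂ, smul_smul]
    norm_num
  have hH : H.1.IsHermitian := by
    simp [Matrix.IsHermitian, hHdef, toeplitzAdjoint, Matrix.conjTranspose_smul, add_comm]
  have hK : K.1.IsHermitian := by
    simp [Matrix.IsHermitian, hKdef, toeplitzAdjoint, Matrix.conjTranspose_smul]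
    module
  have hq : ∀ v : Fin n → ℂ,
      star v ⬝ᵥ (toeplitzAdjoint X).1.mulVec v = star (star v ⬝ᵥ X.1.mulVec v) :=
    quadForm_conjTranspose X.1
  have h1 : ‖φ H‖ ≤ c := by
    refine toeplitzState_real_le hφ H hH c fun v => ?_
    have : star v ⬝ᵥ H.1.mulVec v = ((star v ⬝ᵥ X.1.mulVec v).re : ℂ) := by
      simp only [hHdef, Submodule.coe_smul, Submodule.coe_add, Matrix.smul_mulVec,
        Matrix.add_mulVec, dotProduct_smul, dotProduct_add, hq, Complex.re_eq_add_conj,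
        smul_eq_mul, starRingEnd_apply]
      ring
    rw [this, Complex.norm_real]
    exact (Complex.abs_re_le_norm _).trans (hc v)
  have h2 : ‖φ K‖ ≤ c := by
    refine toeplitzState_real_le hφ K hK c fun v => ?_
    have : star v ⬝ᵥ K.1.mulVec v = ((star v ⬝ᵥ X.1.mulVec v).im : ℂ) := by
      simp only [hKdef, Submodule.coe_smul, Submodule.coe_sub, Matrix.smul_mulVec,
        Matrix.sub_mulVec, dotProduct_smul, dotProduct_sub, hq, Complex.im_eq_sub_conj,
        smul_eq_mul, starRingEnd_apply]
      field_simp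
      linear_combination (-(star v ⬝ᵥ X.1.mulVec v - star (star v ⬝ᵥ X.1.mulVec v))) * Complex.I_sq
    rw [this, Complex.norm_real]
    exact (Complex.abs_im_le_norm _).trans (hc v)
  rw [hX, map_add, map_smul φ Complex.I K]
  refine (norm_add_le _ _).trans ?_
  rw [norm_smul Complex.I (φ K), Complex.norm_I, one_mul]
  linarith

/-! ### Compression of functions and symbols of Toeplitz matrices -/

/-- The compression of the multiplication operator by `f` to the span of `n` consecutive Fourier
modes, a Toeplitz matrix. -/
noncomputable def circleCompression (n : ℕ) : C(S1, ℂ) →ₗ[ℂ] toeplitzSystem n where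
  toFun f := toeplitzOf n (fourierCoeff f)
  map_add' f g := by
    ext a b
    simp only [toeplitzOf_apply, Submodule.coe_add, Matrix.add_apply]
    exact congrFun (fourierCoeff.add (circle_integrable f.continuous)
      (circle_integrable g.continuous)) _
  map_smul' c f := by
    ext a b
    exact fourierCoeff.const_smul f c _

/-- The symbol of a matrix: its expectation in the vector states of the normalised
exponentials. -/
noncomputable def matrixSymbol {n : ℕ} (T : Matrix (Fin n) (Fin n) ℂ) : C(S1, ℂ) :=
  (n : ℂ)⁻¹ • ∑ p : Fin n × Fin n, T p.1 p.2 • fourier ((p.1 : ℤ) - p.2)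

theorem star_fourier (k : ℤ) (x : S1) : star (fourier k x) = fourier (-k) x :=
  fourier_neg.symm

/-- This identifies vector states with densities: on compressions, the vector `v` acts as
integration against the squared modulus of the trigonometric polynomial with coefficients `v`. -/
theorem quadForm_compression {n : ℕ} (f : C(S1, ℂ)) (v : Fin n → ℂ) :
    star v ⬝ᵥ (circleCompression n f).1.mulVec v =
      ∫ x, f x * ((‖∑ b, v b * fourier (b : ℤ) x‖ ^ 2 : ℝ) : ℂ) ∂haarS1 := by
  have h1 : ∀ x : S1, f x * ((‖∑ b, v b * fourier (b : ℤ) x‖ ^ 2 : ℝ) : ℂ) =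
      ∑ a, ∑ b, star (v a) * v b * (fourier (-((a : ℤ) - b)) x • f x) := by
    intro x
    push_cast
    rw [← Complex.conj_mul', map_sum, Finset.sum_mul_sum, Finset.mul_sum]
    refine Finset.sum_congr rfl fun a _ => ?_
    rw [Finset.mul_sum]
    refine Finset.sum_congr rfl fun b _ => ?_
    rw [neg_sub, sub_eq_add_neg, fourier_add, ← star_fourier, map_mul]
    simp only [smul_eq_mul, starRingEnd_apply]
    ring
  simp only [h1]
  rw [MeasureTheory.integral_finsetSum _ fun a _ => circle_integrable (by fun_prop)]
  simp only [dotProduct, Matrix.mulVec, Finset.mul_sum]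
  refine Finset.sum_congr rfl fun a _ => ?_
  rw [MeasureTheory.integral_finsetSum _ fun b _ => circle_integrable (by fun_prop)]
  refine Finset.sum_congr rfl fun b _ => ?_
  rw [MeasureTheory.integral_const_mul]
  change star (v a) * (fourierCoeff f ((a : ℤ) - b) * v b) = _
  rw [fourierCoeff]
  ring

theorem fourierCoeff_sum_fourier {ι : Type*} (s : Finset ι) (c : ι → ℂ) (k : ι → ℤ) (l : ℤ) :
    fourierCoeff (fun x : S1 => ∑ i ∈ s, c i * fourier (k i) x) l =
      ∑ i ∈ s, c i * (if k i = l then 1 else 0) := by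
  have h : ∀ x : S1, fourier (-l) x • ∑ i ∈ s, c i * fourier (k i) x =
      ∑ i ∈ s, c i * fourier (k i - l) x := by
    intro x
    rw [smul_eq_mul, Finset.mul_sum]
    refine Finset.sum_congr rfl fun i _ => ?_
    rw [sub_eq_add_neg, fourier_add]
    ring
  rw [fourierCoeff]
  simp only [h]
  rw [MeasureTheory.integral_finsetSum _ fun a _ => circle_integrable (by fun_prop)]
  refine Finset.sum_congr rfl fun i _ => ?_
  rw [MeasureTheory.integral_const_mul, integral_fourier]
  simp only [sub_eq_zero]

theorem circleSmooth_sum_fourier {ι : Type*} (s : Finset ι) (c : ι → ℂ) (k : ι → ℤ) :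
    CircleSmooth fun x => ∑ i ∈ s, c i * fourier (k i) x :=
  ContDiff.sum fun i _ => contDiff_const.mul (circleSmooth_fourier (k i))

theorem circleDirac_sum_fourier {ι : Type*} (s : Finset ι) (c : ι → ℂ) (k : ι → ℤ) (x : S1) :
    circleDirac (fun x => ∑ i ∈ s, c i * fourier (k i) x) x =
      ∑ i ∈ s, c i * (k i * fourier (k i) x) := by
  induction x using QuotientAddGroup.induction_on with
  | H t =>
    have h := circleDirac_coe (fun x => ∑ i ∈ s, c i * fourier (k i) x) t
    refine h.trans ?_
    have hd : ∀ i ∈ s, DifferentiableAt ℝ (fun r : ℝ => c i * fourier (k i) (r : S1)) t :=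
      fun i _ => (ContDiff.differentiable (circleSmooth_fourier (k i)) (by simp) t).const_mul _
    rw [deriv_fun_sum hd, Finset.mul_sum]
    refine Finset.sum_congr rfl fun i _ => ?_
    have h2 := circleDirac_coe (fourier (k i) : C(S1, ℂ)) t
    rw [circleDirac_fourier] at h2
    rw [deriv_const_mul_field, mul_left_comm, ← h2]

/-! ### Pulling back states to the circle -/

theorem compression_posSemidef {n : ℕ} (f : C(S1, ℂ)) (hf : ∀ x, 0 ≤ f x) :
    (circleCompression n f).1.PosSemidef := by
  refine Matrix.posSemidef_iff_dotProduct_mulVec.2 ⟨?_, fun v => ?_⟩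
  · ext a b
    change star (fourierCoeff f ((b : ℤ) - a)) = fourierCoeff f ((a : ℤ) - b)
    rw [fourierCoeff, fourierCoeff, ← starRingEnd_apply, ← integral_conj]
    congr 1
    ext x
    rw [smul_eq_mul, map_mul, ← fourier_neg, neg_neg, Complex.conj_eq_iff_im.2
      (Complex.nonneg_iff.1 (hf x)).2.symm, neg_sub, smul_eq_mul]
  · rw [quadForm_compression]
    have h : ∀ x, f x * ((‖∑ b, v b * fourier (b : ℤ) x‖ ^ 2 : ℝ) : ℂ) =
        (((f x).re * ‖∑ b, v b * fourier (b : ℤ) x‖ ^ 2 : ℝ) : ℂ) := by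
      intro x
      have h1 : f x = ((f x).re : ℂ) :=
        Complex.ext rfl (by simp [← (Complex.nonneg_iff.1 (hf x)).2])
      rw [Complex.ofReal_mul, ← h1]
    simp only [h]
    rw [integral_complex_ofReal, Complex.zero_le_real]
    exact MeasureTheory.integral_nonneg fun x =>
      mul_nonneg (Complex.nonneg_iff.1 (hf x)).1 (sq_nonneg _)

theorem compression_one (n : ℕ) : circleCompression n 1 = ⟨1, one_mem_toeplitzSystem n⟩ := by
  ext a b
  change fourierCoeff (fun _ : S1 => (1 : ℂ)) ((a : ℤ) - b) = (1 : Matrix (Fin n) (Fin n) ℂ) a b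
  have h := fourierCoeff_sum_fourier {()} (fun _ => 1) (fun _ => 0) ((a : ℤ) - b)
  simp only [Finset.sum_singleton, fourier_zero, one_mul] at h
  rw [h, Matrix.one_apply]
  refine if_congr ?_ rfl rfl
  rw [Fin.ext_iff]
  omega

theorem comp_compression_mem {n : ℕ} {φ : toeplitzSystem n →ₗ[ℂ] ℂ} (hφ : φ ∈ toeplitzStates n) :
    φ ∘ₗ circleCompression n ∈ circleStates :=
  ⟨fun f hf => hφ.1 _ (compression_posSemidef f hf), by
    rw [LinearMap.comp_apply, compression_one, hφ.2]⟩

/-- The state of `C(S¹)` obtained from a state of the Toeplitz system by compression. -/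
noncomputable def pullbackState {n : ℕ} (φ : toeplitzStates n) : circleStates :=
  ⟨φ.1 ∘ₗ circleCompression n, comp_compression_mem φ.2⟩

/-! ### Comparison of the Lipschitz seminorms -/

theorem toEuclideanCLM_apply_coord {n : ℕ} (A : Matrix (Fin n) (Fin n) ℂ)
    (v : EuclideanSpace ℂ (Fin n)) (a : Fin n) :
    Matrix.toEuclideanCLM (n := Fin n) (𝕜 := ℂ) A v a = ∑ b, A a b * v b := by
  rfl

theorem norm_quadForm_le {n : ℕ} (A : Matrix (Fin n) (Fin n) ℂ) (v : Fin n → ℂ) :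
    ‖star v ⬝ᵥ A.mulVec v‖ ≤
      ‖Matrix.toEuclideanCLM (n := Fin n) (𝕜 := ℂ) A‖ * ∑ i, ‖v i‖ ^ 2 := by
  set w : EuclideanSpace ℂ (Fin n) := WithLp.toLp 2 v with hw
  have h1 : star v ⬝ᵥ A.mulVec v =
      inner ℂ w (Matrix.toEuclideanCLM (n := Fin n) (𝕜 := ℂ) A w) := by
    simp only [PiLp.inner_apply, dotProduct, RCLike.inner_apply]
    refine Finset.sum_congr rfl fun i _ => ?_
    rw [mul_comm]
    rfl
  have h2 : ∑ i, ‖v i‖ ^ 2 = ‖w‖ ^ 2 := (EuclideanSpace.norm_sq_eq w).symm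
  rw [h1, h2]
  refine (norm_inner_le_norm _ _).trans ?_
  have := (Matrix.toEuclideanCLM (n := Fin n) (𝕜 := ℂ) A).le_opNorm w
  nlinarith [norm_nonneg w]

theorem sum_sq_col_le {n : ℕ} (A : Matrix (Fin n) (Fin n) ℂ) (b : Fin n) :
    ∑ a, ‖A a b‖ ^ 2 ≤ ‖Matrix.toEuclideanCLM (n := Fin n) (𝕜 := ℂ) A‖ ^ 2 := by
  have h1 := (Matrix.toEuclideanCLM (n := Fin n) (𝕜 := ℂ) A).le_opNorm
    (EuclideanSpace.single b 1)
  have h2 : ∀ a, Matrix.toEuclideanCLM (n := Fin n) (𝕜 := ℂ) A (EuclideanSpace.single b 1) a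
      = A a b := by
    intro a
    simp [EuclideanSpace.single]
  simp only [PiLp.norm_single, norm_one, mul_one] at h1
  have h3 := pow_le_pow_left₀ (norm_nonneg _) h1 2
  rw [EuclideanSpace.norm_sq_eq] at h3
  simpa only [h2] using h3

/-- Differentiating the symbol at `x` gives `n⁻¹ ⟨v, [D_n, T] v⟩`, where `v` is the vector of
exponentials at `x` and `‖v‖² = n`. -/
theorem matrixSymbol_mem_circleLipBall {n : ℕ} (T : toeplitzSystem n)
    (hT : T ∈ toeplitzLipBall n) : matrixSymbol T.1 ∈ circleLipBall := by
  have h0 : (matrixSymbol T.1 : S1 → ℂ) = fun x => ∑ p : Fin n × Fin n,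
      ((n : ℂ)⁻¹ * T.1 p.1 p.2) * fourier ((p.1 : ℤ) - p.2) x := by
    ext x
    simp [matrixSymbol, Finset.mul_sum, mul_assoc]
  refine mem_circleLipBall_of_norm_le (by rw [h0]; exact circleSmooth_sum_fourier _ _ _)
    fun x => ?_
  rw [h0, circleDirac_sum_fourier]
  set v : Fin n → ℂ := fun b => fourier (-(b : ℤ)) x with hv
  have h1 : ∑ p : Fin n × Fin n, ((n : ℂ)⁻¹ * T.1 p.1 p.2) *
      ((((p.1 : ℤ) - p.2 : ℤ) : ℂ) * fourier ((p.1 : ℤ) - p.2) x) =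
      (n : ℂ)⁻¹ * (star v ⬝ᵥ (toeplitzDirac n * T.1 - T.1 * toeplitzDirac n).mulVec v) := by
    rw [Fintype.sum_prod_type]
    simp only [dotProduct, Matrix.mulVec, Finset.mul_sum, toeplitzComm_apply, hv, Pi.star_apply,
      star_fourier, neg_neg]
    refine Finset.sum_congr rfl fun a _ => Finset.sum_congr rfl fun b _ => ?_
    rw [sub_eq_add_neg (a : ℤ), fourier_add]
    push_cast
    ring
  have h2 : ∑ i, ‖v i‖ ^ 2 = n := by
    simp [hv, Circle.norm_coe, fourier_apply]
  have h3 := norm_quadForm_le (toeplitzDirac n * T.1 - T.1 * toeplitzDirac n) v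
  rw [h1, norm_mul, norm_inv, Complex.norm_natCast]
  rw [h2] at h3
  have h4 : ‖Matrix.toEuclideanCLM (n := Fin n) (𝕜 := ℂ)
    (toeplitzDirac n * T.1 - T.1 * toeplitzDirac n)‖ ≤ 1 := hT
  rcases Nat.eq_zero_or_pos n with rfl | hn
  · simp
  rw [inv_mul_le_iff₀ (by positivity), mul_one]
  exact h3.trans (mul_le_of_le_one_left (by positivity) h4)

/-- The commutator of the compression is the compression of multiplication by `D f`. A unit vector
becomes a trigonometric polynomial `g` of `L²` norm one, and the coordinates of its image are some
of the Fourier coefficients of `D f * g`, so Bessel's inequality applies. -/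
theorem compression_mem_toeplitzLipBall (n : ℕ) {f : C(S1, ℂ)} (hf : f ∈ circleLipBall) :
    circleCompression n f ∈ toeplitzLipBall n := by
  refine ContinuousLinearMap.opNorm_le_of_unit_norm zero_le_one fun ξ hξ => ?_
  set g : S1 → ℂ := fun x => ∑ b : Fin n, ξ b * fourier (b : ℤ) x with hg
  have hgs : CircleSmooth g := circleSmooth_sum_fourier _ _ _
  have hgc := hgs.continuous
  have hfc := circleSmooth_deriv_continuous hf.1
  have h1 : ∫ x, ‖g x‖ ^ 2 ∂haarS1 ≤ 1 := by
    have h2 := hasSum_sq_fourierCoeff_of_continuous hgs.continuous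
    have h3 : ∀ l : ℤ, fourierCoeff g l = ∑ b : Fin n, ξ b * (if (b : ℤ) = l then 1 else 0) :=
      fun l => fourierCoeff_sum_fourier _ _ _ l
    have h4 : HasSum (fun k => ‖fourierCoeff g k‖ ^ 2)
        (∑ k ∈ (Finset.univ : Finset (Fin n)).map (Fin.valEmbedding.trans Nat.castEmbedding), ‖fourierCoeff g k‖ ^ 2) := by
      refine hasSum_sum_of_ne_finset_zero fun l hl => ?_
      rw [h3, Finset.sum_eq_zero]
      · simp
      · intro b _
        rw [if_neg, mul_zero]
        rintro rfl
        exact hl (Finset.mem_map_of_mem _ (Finset.mem_univ b))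
    rw [h2.unique h4, Finset.sum_map]
    have h5 : ∀ b : Fin n, fourierCoeff g (b : ℤ) = ξ b := by
      intro b
      rw [h3, Finset.sum_eq_single b]
      · simp
      · intro c _ hc
        rw [if_neg, mul_zero]
        intro h
        exact hc (Fin.ext (by exact_mod_cast h))
      · simp
    refine le_of_eq ((Finset.sum_congr rfl fun b _ => ?_).trans (b := ∑ b, ‖ξ b‖ ^ 2) ?_)
    · exact congrArg (fun z : ℂ => ‖z‖ ^ 2) (h5 b)
    rw [← EuclideanSpace.norm_sq_eq, hξ, one_pow]
  have h6 := circleLipBall_integral_le hf.1 hf.2 hgs h1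
  have h7 := hasSum_sq_fourierCoeff_of_continuous (hfc.mul hgc)
  have h8 : ∀ a : Fin n, Matrix.toEuclideanCLM (n := Fin n) (𝕜 := ℂ)
      (toeplitzDirac n * (circleCompression n f).1 - (circleCompression n f).1 * toeplitzDirac n)
        ξ a = fourierCoeff (circleDirac f * g) (a : ℤ) := by
    intro a
    rw [toEuclideanCLM_apply_coord]
    have h9 : ∀ x : S1, fourier (-(a : ℤ)) x • (circleDirac f * g) x =
        ∑ b : Fin n, ξ b * (fourier (-((a : ℤ) - b)) x • circleDirac f x) := by
      intro x
      simp only [hg, Pi.mul_apply, Finset.mul_sum, smul_eq_mul]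
      refine Finset.sum_congr rfl fun b _ => ?_
      rw [neg_sub, sub_eq_neg_add, fourier_add]
      ring
    rw [fourierCoeff]
    simp only [h9]
    rw [MeasureTheory.integral_finsetSum _ fun a _ => circle_integrable (by fun_prop)]
    refine Finset.sum_congr rfl fun b _ => ?_
    rw [MeasureTheory.integral_const_mul, toeplitzComm_apply]
    have h10 := fourierCoeff_circleDirac hf.1 ((a : ℤ) - b)
    change (((a : ℕ) : ℂ) - ((b : ℕ) : ℂ)) * fourierCoeff f ((a : ℤ) - b) * ξ b =
      ξ b * fourierCoeff (circleDirac f) ((a : ℤ) - b)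
    rw [h10]
    push_cast
    ring
  have h11 : ‖Matrix.toEuclideanCLM (n := Fin n) (𝕜 := ℂ)
      (toeplitzDirac n * (circleCompression n f).1 - (circleCompression n f).1 * toeplitzDirac n)
        ξ‖ ^ 2 ≤ 1 := by
    rw [EuclideanSpace.norm_sq_eq]
    simp only [h8]
    refine le_trans ?_ h6
    have h12 := sum_le_hasSum ((Finset.univ : Finset (Fin n)).map (Fin.valEmbedding.trans Nat.castEmbedding)) (fun k _ => sq_nonneg _) h7
    rw [Finset.sum_map] at h12
    exact h12
  exact (sq_le_one_iff₀ (norm_nonneg _)).1 h11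

/-- Entries on one diagonal agree, so the symbol collects `n - |k|` equal terms at frequency `k` and
divides by `n`. -/
theorem compression_matrixSymbol_apply {n : ℕ} (hn : 0 < n) (T : toeplitzSystem n)
    (a b : Fin n) : (circleCompression n (matrixSymbol T.1)).1 a b =
      (1 - |((a : ℝ) - b)| / n : ℝ) * T.1 a b := by
  have h0 : (matrixSymbol T.1 : S1 → ℂ) = fun x => ∑ p : Fin n × Fin n,
      ((n : ℂ)⁻¹ * T.1 p.1 p.2) * fourier ((p.1 : ℤ) - p.2) x := by
    ext x
    simp [matrixSymbol, Finset.mul_sum, mul_assoc]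
  change fourierCoeff (matrixSymbol T.1 : S1 → ℂ) ((a : ℤ) - b) = _
  rw [h0, fourierCoeff_sum_fourier]
  have h1 : ∀ p : Fin n × Fin n, (n : ℂ)⁻¹ * T.1 p.1 p.2 *
      (if (p.1 : ℤ) - p.2 = (a : ℤ) - b then 1 else 0) =
      (n : ℂ)⁻¹ * T.1 a b * (if (p.1 : ℤ) - p.2 = (a : ℤ) - b then 1 else 0) := by
    intro p
    split_ifs with h
    · rw [toeplitzSystem_apply_eq T _ _ _ _ h]
    · simp
  rw [Finset.sum_congr rfl fun p _ => h1 p, ← Finset.mul_sum, Fintype.sum_prod_type,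
    sum_fin_sub_eq]
  have h2 : (((n - ((a : ℤ) - b).natAbs : ℕ) : ℝ) : ℂ) = ((n - |((a : ℝ) - b)| : ℝ) : ℂ) := by
    rw [Nat.cast_sub (by omega), Nat.cast_natAbs]
    push_cast
    rfl
  have h3 : (n : ℂ) ≠ 0 := by exact_mod_cast hn.ne'
  rw [← Complex.ofReal_natCast (n - ((a : ℤ) - b).natAbs), h2]
  push_cast
  field_simp

/-- The difference has entries `(|a - b|/n) T a b`, equal in modulus to `n⁻¹` times those of the
commutator. The columns of the commutator have norm at most `1`, so its Hilbert-Schmidt norm is at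
most `√n`, and Cauchy-Schwarz bounds the quadratic form by `1/√n`. -/
theorem norm_state_sub_compression_le {n : ℕ} (hn : 0 < n) {φ : toeplitzSystem n →ₗ[ℂ] ℂ}
    (hφ : φ ∈ toeplitzStates n) {T : toeplitzSystem n} (hT : T ∈ toeplitzLipBall n) :
    ‖φ (T - circleCompression n (matrixSymbol T.1))‖ ≤ 2 * (Real.sqrt n)⁻¹ := by
  refine toeplitzState_norm_le hφ _ _ fun v => ?_
  set X := T - circleCompression n (matrixSymbol T.1) with hX
  set A := toeplitzDirac n * T.1 - T.1 * toeplitzDirac n with hA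
  have hA1 : ‖Matrix.toEuclideanCLM (n := Fin n) (𝕜 := ℂ) A‖ ≤ 1 := hT
  have hn' : (0 : ℝ) < n := by exact_mod_cast hn
  have h1 : ∀ a b, ‖X.1 a b‖ = (n : ℝ)⁻¹ * ‖A a b‖ := by
    intro a b
    have h2 : X.1 a b = ((|((a : ℝ) - b)| / n : ℝ) : ℂ) * T.1 a b := by
      have := compression_matrixSymbol_apply hn T a b
      rw [hX, Submodule.coe_sub, Matrix.sub_apply, this]
      push_cast
      ring
    have h3 : ((a : ℕ) : ℂ) - ((b : ℕ) : ℂ) = (((a : ℝ) - b : ℝ) : ℂ) := by push_cast; rfl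
    rw [h2, hA, toeplitzComm_apply, norm_mul, norm_mul, h3, Complex.norm_real, Complex.norm_real,
      norm_div, Real.norm_eq_abs, Real.norm_eq_abs, abs_abs, Real.norm_eq_abs, abs_of_pos hn']
    ring
  have h4 : ∑ p : Fin n × Fin n, ‖A p.1 p.2‖ ^ 2 ≤ n := by
    rw [Fintype.sum_prod_type, Finset.sum_comm]
    calc ∑ b, ∑ a, ‖A a b‖ ^ 2 ≤ ∑ b : Fin n, (1 : ℝ) :=
          Finset.sum_le_sum fun b _ => (sum_sq_col_le A b).trans
            (pow_le_one₀ (norm_nonneg _) hA1)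
      _ = n := by simp
  have h5 : ‖star v ⬝ᵥ X.1.mulVec v‖ ≤
      (n : ℝ)⁻¹ * ∑ p : Fin n × Fin n, (‖v p.1‖ * ‖v p.2‖) * ‖A p.1 p.2‖ := by
    simp only [dotProduct, Matrix.mulVec, Finset.mul_sum]
    rw [Fintype.sum_prod_type]
    refine (norm_sum_le _ _).trans (Finset.sum_le_sum fun a _ => ?_)
    refine (norm_sum_le _ _).trans (Finset.sum_le_sum fun b _ => le_of_eq ?_)
    rw [norm_mul, norm_mul, h1, Pi.star_apply, norm_star]
    ring
  have h6 : ∑ p : Fin n × Fin n, (‖v p.1‖ * ‖v p.2‖) ^ 2 = (∑ i, ‖v i‖ ^ 2) ^ 2 := by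
    rw [Fintype.sum_prod_type, sq (∑ i, ‖v i‖ ^ 2), Finset.sum_mul_sum]
    simp only [mul_pow]
  have h7 := Real.sum_mul_le_sqrt_mul_sqrt Finset.univ
    (fun p : Fin n × Fin n => ‖v p.1‖ * ‖v p.2‖) (fun p => ‖A p.1 p.2‖)
  rw [h6, Real.sqrt_sq (by positivity)] at h7
  have h8 : (n : ℝ)⁻¹ * Real.sqrt n = (Real.sqrt n)⁻¹ := by
    rw [← div_eq_inv_mul, Real.sqrt_div_self']
    simp
  rw [← h8]
  calc ‖star v ⬝ᵥ X.1.mulVec v‖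
      ≤ (n : ℝ)⁻¹ * ((∑ i, ‖v i‖ ^ 2) * Real.sqrt n) := by
        refine h5.trans (mul_le_mul_of_nonneg_left (h7.trans ?_) (by positivity))
        exact mul_le_mul_of_nonneg_left (Real.sqrt_le_sqrt h4) (by positivity)
    _ = _ := by ring

/-- Compression preserves Lipschitz balls, so pulling back never increases distances. Conversely
each `T` is replaced by the compression of its symbol, at a cost of `2/√n` for each of the two
states. -/
theorem abs_dist_sub_dist_pullbackState_le {n : ℕ} (hn : 0 < n) (φ ψ : toeplitzStates n) :
    |dist φ ψ - dist (pullbackState φ) (pullbackState ψ)| ≤ 4 * (Real.sqrt n)⁻¹ := by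
  have h0T : (0 : toeplitzSystem n) ∈ toeplitzLipBall n := by simp [toeplitzLipBall]
  have h0C : (0 : C(S1, ℂ)) ∈ circleLipBall :=
    mem_circleLipBall_of_norm_le contDiff_const (by simp [circleDirac])
  have h1 : dist (pullbackState φ) (pullbackState ψ) ≤ dist φ ψ := by
    refine csSup_le ⟨_, 0, h0C, rfl⟩ ?_
    rintro _ ⟨f, hf, rfl⟩
    exact le_csSup (toeplitz_bddAbove n φ.1 φ.2 ψ.1 ψ.2)
      ⟨_, compression_mem_toeplitzLipBall n hf, rfl⟩
  have h2 : dist φ ψ ≤ dist (pullbackState φ) (pullbackState ψ) + 4 * (Real.sqrt n)⁻¹ := by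
    refine csSup_le ⟨_, 0, h0T, rfl⟩ ?_
    rintro _ ⟨T, hT, rfl⟩
    have h3 : ‖φ.1 (circleCompression n (matrixSymbol T.1)) -
        ψ.1 (circleCompression n (matrixSymbol T.1))‖ ≤
        dist (pullbackState φ) (pullbackState ψ) :=
      le_csSup (circle_bddAbove _ (pullbackState φ).2 _ (pullbackState ψ).2)
        ⟨_, matrixSymbol_mem_circleLipBall T hT, rfl⟩
    have h4 := norm_state_sub_compression_le hn φ.2 hT
    have h5 := norm_state_sub_compression_le hn ψ.2 hT
    have h6 : φ.1 T - ψ.1 T = (φ.1 (circleCompression n (matrixSymbol T.1)) -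
        ψ.1 (circleCompression n (matrixSymbol T.1))) +
        (φ.1 (T - circleCompression n (matrixSymbol T.1)) -
        ψ.1 (T - circleCompression n (matrixSymbol T.1))) := by
      simp only [map_sub]
      ring
    change ‖φ.1 T - ψ.1 T‖ ≤ _
    rw [h6]
    refine (norm_add_le _ _).trans ?_
    have h7 := norm_sub_le (φ.1 (T - circleCompression n (matrixSymbol T.1)))
      (ψ.1 (T - circleCompression n (matrixSymbol T.1)))
    linarith
  rw [abs_le]
  constructor
  · have : (0 : ℝ) ≤ 4 * (Real.sqrt n)⁻¹ := by positivity
    linarith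
  · linarith

/-! ### Polynomials with all zeros on the unit circle -/

open Polynomial in
/-- A polynomial inequality on the unit circle remains true after cancelling a common zero. -/
theorem norm_eval_le_of_mul_X_sub_C {A B : ℂ[X]} {C : ℝ} {w : ℂ} (hw : ‖w‖ = 1)
    (h : ∀ z : ℂ, ‖z‖ = 1 →
      ‖((X - Polynomial.C w) * A).eval z‖ ≤ C * ‖((X - Polynomial.C w) * B).eval z‖)
    (z : ℂ) (hz : ‖z‖ = 1) : ‖A.eval z‖ ≤ C * ‖B.eval z‖ := by
  have key : ∀ z : ℂ, ‖z‖ = 1 → z ≠ w → ‖A.eval z‖ ≤ C * ‖B.eval z‖ := by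
    intro z hz hzw
    have h1 := h z hz
    simp only [eval_mul, eval_sub, eval_X, eval_C, norm_mul] at h1
    have h2 : 0 < ‖z - w‖ := norm_pos_iff.2 (sub_ne_zero.2 hzw)
    refine le_of_mul_le_mul_left ?_ h2
    linarith
  by_cases hzw : z = w
  · subst hzw
    -- Approach `z` along the circle: the curve leaves `z` with nonzero speed, so it avoids `z` for
    -- small nonzero times and the inequality passes to the limit.
    let g : ℝ → ℂ := fun t => z * Complex.exp (t * Complex.I)
    have hg : HasDerivAt g (z * (Complex.exp ((0 : ℝ) * Complex.I) * (1 * Complex.I))) 0 :=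
      (((hasDerivAt_id (0 : ℝ)).ofReal_comp.mul_const Complex.I).cexp).const_mul z
    have hz0 : z ≠ 0 := by
      rintro rfl
      simp at hz
    have hne := hg.eventually_ne (c := z) (by simp [hz0])
    have hgc : Continuous g := by fun_prop
    have hg0 : g 0 = z := by simp [g]
    have hA : Filter.Tendsto (fun t => ‖A.eval (g t)‖) (nhdsWithin 0 {0}ᶜ)
        (nhds ‖A.eval z‖) := by
      have : Continuous fun t => ‖A.eval (g t)‖ := by fun_prop
      have h1 := this.tendsto 0
      rw [hg0] at h1
      exact h1.mono_left nhdsWithin_le_nhds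
    have hB : Filter.Tendsto (fun t => C * ‖B.eval (g t)‖) (nhdsWithin 0 {0}ᶜ)
        (nhds (C * ‖B.eval z‖)) := by
      have : Continuous fun t => C * ‖B.eval (g t)‖ := by fun_prop
      have h1 := this.tendsto 0
      rw [hg0] at h1
      exact h1.mono_left nhdsWithin_le_nhds
    refine le_of_tendsto_of_tendsto hA hB (hne.mono fun t ht => key _ ?_ ht)
    simp [g, hz, Complex.norm_exp_ofReal_mul_I]
  · exact key z hz hzw

open Polynomial in
-- A zero of `B` lies on the circle, where the inequality forces `A` to vanish too. Cancelling the
-- common factor keeps the inequality, so multiplicities are handled by induction on the degree.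
theorem dvd_of_norm_eval_le_on_circle (d : ℕ) : ∀ (A B : ℂ[X]) (C : ℝ), B.natDegree = d → B ≠ 0 →
    (∀ z, B.IsRoot z → ‖z‖ = 1) → (∀ z : ℂ, ‖z‖ = 1 → ‖A.eval z‖ ≤ C * ‖B.eval z‖) → B ∣ A := by
  induction d with
  | zero =>
    intro A B C hd hB _ _
    rw [natDegree_eq_zero] at hd
    obtain ⟨c, rfl⟩ := hd
    exact (isUnit_C.2 (isUnit_iff_ne_zero.2 (by simpa using hB))).dvd
  | succ d ih =>
    intro A B C hd hB hroot h
    obtain ⟨w, hw⟩ := IsAlgClosed.exists_root B (by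
      rw [degree_eq_natDegree hB, hd]
      exact_mod_cast Nat.succ_ne_zero d)
    have hw1 := hroot w hw
    have hA : A.IsRoot w := by
      have h1 := h w hw1
      rw [hw.eq_zero, norm_zero, mul_zero] at h1
      exact norm_le_zero_iff.1 h1
    obtain ⟨B', rfl⟩ := dvd_iff_isRoot.2 hw
    obtain ⟨A', rfl⟩ := dvd_iff_isRoot.2 hA
    have hB' : B' ≠ 0 := right_ne_zero_of_mul hB
    refine mul_dvd_mul_left _ (ih A' B' C ?_ hB' (fun z hz => hroot z ?_)
      (norm_eval_le_of_mul_X_sub_C hw1 h))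
    · rw [natDegree_mul (X_sub_C_ne_zero w) hB', natDegree_X_sub_C] at hd
      omega
    · exact hz.dvd (Dvd.intro_left _ rfl)

/-- The Blaschke factor identity: it compares a linear factor with its reflection both on the circle
and inside the disc. -/
theorem normSq_one_sub_conj_mul_sub (α z : ℂ) :
    ‖1 - star α * z‖ ^ 2 - ‖z - α‖ ^ 2 = (1 - ‖z‖ ^ 2) * (1 - ‖α‖ ^ 2) := by
  simp only [← Complex.normSq_eq_norm_sq, Complex.normSq_apply]
  simp
  ring

open Polynomial in
/-- Reflecting zeros at the unit circle: any polynomial has the same modulus on the circle as a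
polynomial `r` without zeros in the open disc and as its reversal `q`. -/
theorem exists_outer_polynomial (d : ℕ) : ∀ Q : ℂ[X], Q.natDegree = d → Q ≠ 0 →
    ∃ q r : ℂ[X], q.natDegree ≤ d ∧ r.natDegree ≤ d ∧ q.coeff d ≠ 0 ∧
      (∀ z : ℂ, ‖z‖ = 1 → ‖q.eval z‖ = ‖Q.eval z‖ ∧ ‖r.eval z‖ = ‖Q.eval z‖) ∧
      (∀ z : ℂ, ‖z‖ < 1 → r.eval z ≠ 0 ∧ ‖q.eval z‖ ≤ ‖r.eval z‖) ∧
      (∀ z : ℂ, z ≠ 0 → q.eval z = z ^ d * star (r.eval (star z)⁻¹)) := by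
  induction d with
  | zero =>
    intro Q hd hQ
    rw [natDegree_eq_zero] at hd
    obtain ⟨c, rfl⟩ := hd
    have hc : c ≠ 0 := by simpa using hQ
    exact ⟨C (star c), C c, by simp, by simp, by simp [hc], by simp, by simp [hc], by simp⟩
  | succ d ih =>
    intro Q hd hQ
    obtain ⟨α, hα⟩ := IsAlgClosed.exists_root Q (by
      rw [degree_eq_natDegree hQ, hd]
      exact_mod_cast Nat.succ_ne_zero d)
    obtain ⟨Q', rfl⟩ := dvd_iff_isRoot.2 hα
    have hQ' : Q' ≠ 0 := right_ne_zero_of_mul hQ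
    rw [natDegree_mul (X_sub_C_ne_zero α) hQ', natDegree_X_sub_C] at hd
    obtain ⟨q, r, hq, hr, hc, h1, h2, h3⟩ := ih Q' (by omega) hQ'
    have hL : (1 - C (star α) * X : ℂ[X]).natDegree ≤ 1 := by compute_degree
    have hL' : (X - C α : ℂ[X]).natDegree ≤ 1 := by compute_degree
    have hcirc : ∀ z : ℂ, ‖z‖ = 1 → ‖1 - star α * z‖ = ‖z - α‖ := by
      intro z hz
      have := normSq_one_sub_conj_mul_sub α z
      rw [hz] at this
      exact (sq_eq_sq₀ (norm_nonneg _) (norm_nonneg _)).1 (by linarith)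
    have hdeg : ∀ a b : ℂ[X], a.natDegree ≤ 1 → b.natDegree ≤ d → (a * b).natDegree ≤ d + 1 := by
      intro a b ha hb
      exact natDegree_mul_le.trans (by omega)
    have hcoeff : ∀ a b : ℂ[X], a.natDegree ≤ 1 → b.natDegree ≤ d →
        (a * b).coeff (d + 1) = a.coeff 1 * b.coeff d := by
      intro a b ha hb
      rw [add_comm d 1]
      exact coeff_mul_add_eq_of_natDegree_le ha hb
    -- The factors `z - α` and `1 - star α * z` are shared out so that `r` receives the one without
    -- zeros in the open disc.
    rcases le_or_gt ‖α‖ 1 with hα1 | hα1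
    · refine ⟨(X - C α) * q, (1 - C (star α) * X) * r, hdeg _ _ hL' hq, hdeg _ _ hL hr, ?_,
        fun z hz => ?_, fun z hz => ⟨?_, ?_⟩, fun z hz => ?_⟩
      · rw [hcoeff _ _ hL' hq]
        simpa [coeff_X, coeff_C] using hc
      · simp only [eval_mul, eval_sub, eval_X, eval_C, eval_one, norm_mul, h1 z hz, hcirc z hz,
          and_self]
      · simp only [eval_mul, eval_sub, eval_X, eval_C, eval_one]
        refine mul_ne_zero (sub_ne_zero.2 fun h => ?_) (h2 z hz).1
        have h4 := congrArg norm h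
        rw [norm_mul, norm_star, norm_one] at h4
        nlinarith [norm_nonneg z, norm_nonneg α]
      · simp only [eval_mul, eval_sub, eval_X, eval_C, eval_one, norm_mul]
        refine mul_le_mul ?_ (h2 z hz).2 (norm_nonneg _) (norm_nonneg _)
        have := normSq_one_sub_conj_mul_sub α z
        refine (sq_le_sq₀ (norm_nonneg _) (norm_nonneg _)).1 ?_
        have h5 : 0 ≤ (1 - ‖z‖ ^ 2) * (1 - ‖α‖ ^ 2) :=
          mul_nonneg (by nlinarith [norm_nonneg z]) (by nlinarith [norm_nonneg α])
        linarith
      · simp only [eval_mul, eval_sub, eval_X, eval_C, eval_one, h3 z hz, star_mul', star_sub,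
          star_one, star_star, star_inv₀]
        field_simp
        ring
    · refine ⟨(1 - C (star α) * X) * q, (X - C α) * r, hdeg _ _ hL hq, hdeg _ _ hL' hr, ?_,
        fun z hz => ?_, fun z hz => ⟨?_, ?_⟩, fun z hz => ?_⟩
      · rw [hcoeff _ _ hL hq]
        have hα0 : α ≠ 0 := by
          rintro rfl
          simp at hα1
          linarith
        simpa [coeff_X, coeff_C, coeff_one, hα0] using hc
      · simp only [eval_mul, eval_sub, eval_X, eval_C, eval_one, norm_mul, h1 z hz, hcirc z hz,
          and_self]
      · simp only [eval_mul, eval_sub, eval_X, eval_C]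
        refine mul_ne_zero (sub_ne_zero.2 fun h => ?_) (h2 z hz).1
        rw [h] at hz
        linarith
      · simp only [eval_mul, eval_sub, eval_X, eval_C, eval_one, norm_mul]
        refine mul_le_mul ?_ (h2 z hz).2 (norm_nonneg _) (norm_nonneg _)
        have := normSq_one_sub_conj_mul_sub α z
        refine (sq_le_sq₀ (norm_nonneg _) (norm_nonneg _)).1 ?_
        have h5 : 0 ≤ (1 - ‖z‖ ^ 2) * (‖α‖ ^ 2 - 1) :=
          mul_nonneg (by nlinarith [norm_nonneg z]) (by nlinarith [norm_nonneg α])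
        linarith
      · simp only [eval_mul, eval_sub, eval_X, eval_C, eval_one, h3 z hz, star_sub,
          star_star, star_inv₀, star_mul']
        field_simp
        ring

open Polynomial in
-- Inside the disc `|z^k q| < |r|`, so there is no zero. The reversal relation makes the zero set
-- symmetric under `z ↦ 1 / star z`, which excludes zeros outside as well.
theorem natDegree_and_roots_of_self_inversive {d k : ℕ} (hk : 0 < k) {q r : ℂ[X]}
    (hq : q.natDegree ≤ d) (hr : r.natDegree ≤ d) (hc : q.coeff d ≠ 0)
    (h2 : ∀ z : ℂ, ‖z‖ < 1 → r.eval z ≠ 0 ∧ ‖q.eval z‖ ≤ ‖r.eval z‖)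
    (h3 : ∀ z : ℂ, z ≠ 0 → q.eval z = z ^ d * star (r.eval (star z)⁻¹)) :
    (X ^ k * q + r).natDegree = k + d ∧ ∀ z, (X ^ k * q + r).IsRoot z → ‖z‖ = 1 := by
  constructor
  · refine natDegree_eq_of_le_of_coeff_ne_zero ?_ ?_
    · refine natDegree_add_le_of_degree_le (natDegree_mul_le.trans ?_) (by omega)
      rw [natDegree_X_pow]
      omega
    · rw [coeff_add, coeff_eq_zero_of_natDegree_lt (p := r) (by omega), add_zero, add_comm k d,
        coeff_X_pow_mul]
      exact hc
  · have key : ∀ z : ℂ, ‖z‖ < 1 → (X ^ k * q + r).eval z ≠ 0 := by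
      intro z hz h
      simp only [eval_add, eval_mul, eval_pow, eval_X] at h
      obtain ⟨h4, h5⟩ := h2 z hz
      have h6 : ‖z‖ ^ k * ‖q.eval z‖ = ‖r.eval z‖ := by
        rw [← norm_pow, ← norm_mul, eq_neg_of_add_eq_zero_left h, norm_neg]
      have h7 : 0 < ‖r.eval z‖ := norm_pos_iff.2 h4
      have h8 : ‖z‖ ^ k < 1 := pow_lt_one₀ (norm_nonneg _) hz hk.ne'
      nlinarith [norm_nonneg (q.eval z), pow_nonneg (norm_nonneg z) k]
    intro z hz
    rcases lt_trichotomy ‖z‖ 1 with h | h | h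
    · exact absurd hz (key z h)
    · exact h
    · exfalso
      have hz0 : z ≠ 0 := by
        rintro rfl
        simp at h
        linarith
      have hw0 : (star z)⁻¹ ≠ 0 := inv_ne_zero (star_ne_zero.2 hz0)
      have hw : ‖(star z)⁻¹‖ < 1 := by
        rw [norm_inv, norm_star]
        exact inv_lt_one_of_one_lt₀ h
      refine key _ hw ?_
      have h4 := h3 _ hw0
      rw [star_inv₀, star_star, inv_inv] at h4
      have h5 := h3 z hz0
      have h6 : (X ^ k * q + r).eval z = 0 := hz
      simp only [eval_add, eval_mul, eval_pow, eval_X] at h6 ⊢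
      have h7 : star (r.eval (star z)⁻¹) = (z ^ d)⁻¹ * q.eval z := by
        rw [h5, inv_mul_cancel_left₀ (pow_ne_zero d hz0)]
      have h8 : r.eval (star z)⁻¹ = star ((z ^ d)⁻¹ * q.eval z) := by
        rw [← h7, star_star]
      rw [h4, h8, eq_neg_of_add_eq_zero_right h6]
      simp only [star_neg, star_mul', star_pow, star_inv₀]
      have hs : (star z) ≠ 0 := star_ne_zero.2 hz0
      generalize star z = s at hs
      simp only [inv_pow]
      field_simp
      ring

/-! ### Extremal vector states of the Toeplitz system -/

theorem exists_eq_toeplitzOf {n : ℕ} (T : toeplitzSystem n) : ∃ t, T = toeplitzOf n t := by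
  classical
  refine ⟨fun l => if h : ∃ p : Fin n × Fin n, (p.1 : ℤ) - p.2 = l then
    T.1 h.choose.1 h.choose.2 else 0, ?_⟩
  ext a b
  have h : ∃ p : Fin n × Fin n, (p.1 : ℤ) - p.2 = (a : ℤ) - b := ⟨(a, b), rfl⟩
  rw [toeplitzOf_apply, dif_pos h]
  exact toeplitzSystem_apply_eq T _ _ _ _ h.choose_spec.symm

/-- The Toeplitz matrix with ones on one diagonal and zeros elsewhere. -/
def toeplitzShift (n : ℕ) (k : ℤ) : toeplitzSystem n :=
  toeplitzOf n fun l => if l = k then 1 else 0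

theorem toeplitzShift_zero (n : ℕ) : toeplitzShift n 0 = ⟨1, one_mem_toeplitzSystem n⟩ := by
  ext a b
  simp only [toeplitzShift, toeplitzOf_apply, Matrix.one_apply]
  refine if_congr ?_ rfl rfl
  rw [Fin.ext_iff]
  omega

theorem toeplitzOf_eq_sum (n : ℕ) (t : ℤ → ℂ) : toeplitzOf n t =
    ∑ m ∈ Finset.range (2 * n - 1), t (n - 1 - m) • toeplitzShift n (n - 1 - m) := by
  ext a b
  rw [Submodule.coe_sum, Matrix.sum_apply, Finset.sum_eq_single (n - 1 - ((a : ℤ) - b)).toNat]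
  · have h : ((n : ℤ) - 1 - ((n - 1 - ((a : ℤ) - b)).toNat : ℕ)) = (a : ℤ) - b := by omega
    rw [h]
    simp [toeplitzShift]
  · intro m _ hm
    simp only [Submodule.coe_smul, Matrix.smul_apply, toeplitzShift, toeplitzOf_apply]
    rw [if_neg (by omega), smul_zero]
  · intro h
    rw [Finset.mem_range] at h
    omega

theorem toeplitz_functional_ext {n : ℕ} {φ ψ : toeplitzSystem n →ₗ[ℂ] ℂ}
    (h : ∀ m < 2 * n - 1, φ (toeplitzShift n (n - 1 - m)) = ψ (toeplitzShift n (n - 1 - m))) :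
    φ = ψ := by
  refine LinearMap.ext fun T => ?_
  obtain ⟨t, rfl⟩ := exists_eq_toeplitzOf T
  rw [toeplitzOf_eq_sum, map_sum, map_sum]
  refine Finset.sum_congr rfl fun m hm => ?_
  rw [map_smul, map_smul, h m (Finset.mem_range.1 hm)]

/-- The functional `T ↦ ⟨v, T v⟩`. -/
def vectorFunctional {n : ℕ} (v : Fin n → ℂ) : toeplitzSystem n →ₗ[ℂ] ℂ where
  toFun T := star v ⬝ᵥ T.1.mulVec v
  map_add' S T := by simp [Matrix.add_mulVec]
  map_smul' c T := by simp [Matrix.smul_mulVec]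

theorem vectorFunctional_mem {n : ℕ} {v : Fin n → ℂ} (hv : ∑ i, ‖v i‖ ^ 2 = 1) :
    vectorFunctional v ∈ toeplitzStates n := by
  refine ⟨fun T hT => (Matrix.posSemidef_iff_dotProduct_mulVec.1 hT).2 v, ?_⟩
  change star v ⬝ᵥ (1 : Matrix (Fin n) (Fin n) ℂ).mulVec v = 1
  rw [Matrix.one_mulVec]
  have : star v ⬝ᵥ v = ((∑ i, ‖v i‖ ^ 2 : ℝ) : ℂ) := by simp [dotProduct, Complex.conj_mul']
  rw [this, hv, Complex.ofReal_one]

/-- The rank one Toeplitz matrix with entries `z ^ (b - a)`. -/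
noncomputable def toeplitzRankOne (n : ℕ) (z : ℂ) : toeplitzSystem n :=
  toeplitzOf n fun l => z ^ (-l)

theorem toeplitzRankOne_posSemidef (n : ℕ) {z : ℂ} (hz : ‖z‖ = 1) :
    (toeplitzRankOne n z).1.PosSemidef := by
  have hz0 : z ≠ 0 := by
    rintro rfl
    simp at hz
  have hs : star z = z⁻¹ := (Complex.inv_eq_conj hz).symm
  have h := Matrix.posSemidef_vecMulVec_self_star (fun a : Fin n => z ^ (-(a : ℤ)))
  convert h using 1
  ext a b
  simp only [toeplitzRankOne, toeplitzOf_apply, Matrix.vecMulVec_apply, Pi.star_apply]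
  rw [star_zpow₀, hs, inv_zpow', neg_neg, ← zpow_add₀ hz0]
  congr 1
  ring

theorem vectorFunctional_toeplitzRankOne {n : ℕ} (v : Fin n → ℂ) {z : ℂ} (hz : ‖z‖ = 1) :
    vectorFunctional v (toeplitzRankOne n z) = ((‖∑ b, v b * z ^ (b : ℕ)‖ ^ 2 : ℝ) : ℂ) := by
  have hz0 : z ≠ 0 := by
    rintro rfl
    simp at hz
  have hs : star z = z⁻¹ := (Complex.inv_eq_conj hz).symm
  push_cast
  rw [← Complex.conj_mul', map_sum, Finset.sum_mul_sum]
  change star v ⬝ᵥ (toeplitzRankOne n z).1.mulVec v = _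
  simp only [dotProduct, Matrix.mulVec, Finset.mul_sum]
  refine Finset.sum_congr rfl fun a _ => Finset.sum_congr rfl fun b _ => ?_
  rw [toeplitzRankOne, toeplitzOf_apply, neg_sub, zpow_sub₀ hz0, map_mul, map_pow,
    starRingEnd_apply z, hs, inv_pow, zpow_natCast, zpow_natCast]
  simp only [Pi.star_apply, starRingEnd_apply]
  field_simp

open Polynomial in
/-- The polynomial generating the values of a functional on the diagonals. -/
noncomputable def functionalPoly {n : ℕ} (φ : toeplitzSystem n →ₗ[ℂ] ℂ) : ℂ[X] :=
  ∑ m ∈ Finset.range (2 * n - 1), C (φ (toeplitzShift n (n - 1 - m))) * X ^ m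

open Polynomial in
theorem functionalPoly_coeff {n : ℕ} (φ : toeplitzSystem n →ₗ[ℂ] ℂ) {m : ℕ} (hm : m < 2 * n - 1) :
    (functionalPoly φ).coeff m = φ (toeplitzShift n (n - 1 - m)) := by
  rw [functionalPoly, finsetSum_coeff]
  simp only [coeff_C_mul_X_pow]
  rw [Finset.sum_ite_eq]
  rw [if_pos (Finset.mem_range.2 hm)]

open Polynomial in
theorem functionalPoly_natDegree_le {n : ℕ} (φ : toeplitzSystem n →ₗ[ℂ] ℂ) :
    (functionalPoly φ).natDegree ≤ 2 * (n - 1) := by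
  refine natDegree_sum_le_of_forall_le _ _ fun m hm => ?_
  rw [Finset.mem_range] at hm
  exact (natDegree_C_mul_X_pow_le _ _).trans (by omega)

open Polynomial in
-- On the circle the modulus of this polynomial is `|φ|` at a positive rank one matrix, so
-- domination between functionals becomes an inequality between polynomials.
theorem functionalPoly_eval {n : ℕ} (φ : toeplitzSystem n →ₗ[ℂ] ℂ) {z : ℂ} (hz : z ≠ 0) :
    (functionalPoly φ).eval z = z ^ ((n : ℤ) - 1) * φ (toeplitzRankOne n z) := by
  rw [toeplitzRankOne, toeplitzOf_eq_sum, map_sum, Finset.mul_sum, functionalPoly,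
    eval_finsetSum]
  refine Finset.sum_congr rfl fun m _ => ?_
  rw [map_smul, eval_mul, eval_C, eval_pow, eval_X, smul_eq_mul, ← mul_assoc, ← zpow_add₀ hz]
  have : (n : ℤ) - 1 + -((n : ℤ) - 1 - m) = m := by ring
  rw [this, zpow_natCast, mul_comm]

open Polynomial in
-- Testing the domination on rank one matrices gives `|functionalPoly ψ| ≤ c |p|²` on the circle,
-- hence divisibility by `p ^ 2`. Both degrees are bounded by `2 * (n - 1)`, which leaves only a
-- constant quotient.
theorem exists_functionalPoly_eq {n : ℕ} {p : ℂ[X]} (hp : p ≠ 0) (hdeg : p.natDegree = n - 1)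
    (hn : 0 < n) (hroot : ∀ z, p.IsRoot z → ‖z‖ = 1) {ψ : toeplitzSystem n →ₗ[ℂ] ℂ} {c : ℝ}
    (hψ : ∀ T : toeplitzSystem n, T.1.PosSemidef →
      ‖ψ T‖ ≤ c * ‖vectorFunctional (fun b : Fin n => p.coeff b) T‖) :
    ∃ s, functionalPoly ψ = C s * p ^ 2 := by
  have heval : ∀ z, p.eval z = ∑ b : Fin n, p.coeff b * z ^ (b : ℕ) := by
    intro z
    rw [eval_eq_sum_range, hdeg, Nat.sub_add_cancel hn, Finset.sum_range]
  have hdvd : p ^ 2 ∣ functionalPoly ψ := by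
    refine dvd_of_norm_eval_le_on_circle _ _ _ c rfl (pow_ne_zero 2 hp) (fun z hz => ?_)
      fun z hz => ?_
    · refine hroot z ?_
      rw [IsRoot, eval_pow] at hz
      exact pow_eq_zero_iff (two_ne_zero) |>.1 hz
    · have hz0 : z ≠ 0 := by
        rintro rfl
        simp at hz
      rw [functionalPoly_eval ψ hz0, norm_mul, norm_zpow, hz, one_zpow, one_mul]
      refine (hψ _ (toeplitzRankOne_posSemidef n hz)).trans (le_of_eq ?_)
      rw [vectorFunctional_toeplitzRankOne _ hz, ← heval, Complex.norm_real, eval_pow, norm_pow]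
      simp
  obtain ⟨u, hu⟩ := hdvd
  by_cases hu0 : u = 0
  · exact ⟨0, by rw [hu, hu0]; simp⟩
  · have h1 := functionalPoly_natDegree_le ψ
    rw [hu, natDegree_mul (pow_ne_zero 2 hp) hu0, natDegree_pow, hdeg] at h1
    have h2 : u.natDegree = 0 := by omega
    obtain ⟨s, rfl⟩ := natDegree_eq_zero.1 h2
    exact ⟨s, by rw [hu, mul_comm]⟩

open Polynomial in
/-- The vector state of a polynomial of full degree with all zeros on the circle is the only state
dominated by a multiple of it. -/
theorem eq_vectorFunctional_of_dominated {n : ℕ} (hn : 0 < n) {p : ℂ[X]}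
    (hdeg : p.natDegree = n - 1) (hroot : ∀ z, p.IsRoot z → ‖z‖ = 1)
    (hnorm : ∑ b : Fin n, ‖p.coeff b‖ ^ 2 = 1) {ψ : toeplitzSystem n →ₗ[ℂ] ℂ}
    (hψ1 : ψ ∈ toeplitzStates n) {c : ℝ} (hψ : ∀ T : toeplitzSystem n, T.1.PosSemidef →
      ‖ψ T‖ ≤ c * ‖vectorFunctional (fun b : Fin n => p.coeff b) T‖) :
    ψ = vectorFunctional fun b : Fin n => p.coeff b := by
  set φ := vectorFunctional fun b : Fin n => p.coeff b with hφ
  have hφ1 : φ ∈ toeplitzStates n := vectorFunctional_mem hnorm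
  have hp : p ≠ 0 := by
    rintro rfl
    simp at hnorm
  obtain ⟨s, hs⟩ := exists_functionalPoly_eq hp hdeg hn hroot hψ
  obtain ⟨s', hs'⟩ := exists_functionalPoly_eq hp hdeg hn hroot (ψ := φ) (c := 1)
    (by simp [hφ])
  -- The middle coefficient is the value at the identity matrix, so normalisation fixes the
  -- remaining scalar.
  have hm : ∀ χ ∈ toeplitzStates n, (functionalPoly χ).coeff (n - 1) = 1 := by
    intro χ hχ
    rw [functionalPoly_coeff χ (by omega)]
    have : ((n : ℤ) - 1 - (n - 1 : ℕ)) = 0 := by omega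
    rw [this, toeplitzShift_zero, hχ.2]
  have h1 := hm ψ hψ1
  have h2 := hm φ hφ1
  rw [hs, coeff_C_mul] at h1
  rw [hs', coeff_C_mul] at h2
  have hss : s = s' :=
    mul_right_cancel₀ (right_ne_zero_of_mul_eq_one h1) (h1.trans h2.symm)
  refine toeplitz_functional_ext fun m hm => ?_
  rw [← functionalPoly_coeff ψ hm, ← functionalPoly_coeff φ hm, hs, hs', hss]

open Polynomial in
-- A component of weight `a` in a convex decomposition is dominated on positive matrices by `a⁻¹`
-- times the whole.
theorem vectorFunctional_mem_extremePoints {n : ℕ} (hn : 0 < n) {p : ℂ[X]}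
    (hdeg : p.natDegree = n - 1) (hroot : ∀ z, p.IsRoot z → ‖z‖ = 1)
    (hnorm : ∑ b : Fin n, ‖p.coeff b‖ ^ 2 = 1) :
    vectorFunctional (fun b : Fin n => p.coeff b) ∈ Set.extremePoints ℝ (toeplitzStates n) := by
  have key : ∀ x₁ ∈ toeplitzStates n, ∀ x₂ ∈ toeplitzStates n, ∀ a b : ℝ, 0 < a → 0 < b →
      a • x₁ + b • x₂ = vectorFunctional (fun b : Fin n => p.coeff b) →
      x₁ = vectorFunctional (fun b : Fin n => p.coeff b) := by
    intro x₁ h₁ x₂ h₂ a b ha hb hx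
    refine eq_vectorFunctional_of_dominated hn hdeg hroot hnorm h₁ (c := a⁻¹) fun T hT => ?_
    have h3 := h₁.1 T hT
    have h4 := h₂.1 T hT
    have h5 : ‖x₁ T‖ = (x₁ T).re := Complex.re_eq_norm.2 h3 |>.symm
    rw [le_inv_mul_iff₀ ha, ← hx, h5]
    refine le_trans ?_ (Complex.re_le_norm _)
    simp only [LinearMap.add_apply, LinearMap.smul_apply, Complex.add_re, Complex.smul_re,
      smul_eq_mul]
    have := mul_nonneg hb.le (Complex.nonneg_iff.1 h4).1
    linarith
  refine mem_extremePoints.2 ⟨vectorFunctional_mem hnorm, fun x₁ h₁ x₂ h₂ h => ?_⟩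
  obtain ⟨a, b, ha, hb, -, hx⟩ := h
  exact ⟨key x₁ h₁ x₂ h₂ a b ha hb hx, key x₂ h₂ x₁ h₁ b a hb ha (by rw [add_comm, hx])⟩

/-! ### Realising smoothed Fourier coefficients by extremal vector states -/

theorem fourier_eq_zpow (k : ℤ) (x : S1) : fourier k x = (fourier 1 x : ℂ) ^ k := by
  rw [fourier_apply, fourier_one, AddCircle.toCircle_zsmul, Circle.coe_zpow]

theorem fourier_natCast_eq_pow (k : ℕ) (x : S1) : fourier (k : ℤ) x = (fourier 1 x : ℂ) ^ k := by
  rw [fourier_eq_zpow, zpow_natCast]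

theorem norm_fourier_apply (k : ℤ) (x : S1) : ‖(fourier k x : ℂ)‖ = 1 := by
  rw [fourier_apply, Circle.norm_coe]

open Polynomial in
theorem integral_fourier_mul_polynomial (l : ℤ) {d : ℕ} {q r : ℂ[X]} (hq : q.natDegree < d)
    (hr : r.natDegree < d) :
    ∫ x : S1, fourier l x * (q.eval (fourier 1 x) * star (r.eval (fourier 1 x))) ∂haarS1 =
      ∑ i ∈ Finset.range d, ∑ j ∈ Finset.range d,
        q.coeff i * star (r.coeff j) * (if l + i - j = 0 then 1 else 0) := by
  have h : ∀ x : S1, fourier l x * (q.eval (fourier 1 x) * star (r.eval (fourier 1 x))) =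
      ∑ i ∈ Finset.range d, ∑ j ∈ Finset.range d,
        q.coeff i * star (r.coeff j) * fourier (l + i - j) x := by
    intro x
    rw [eval_eq_sum_range' hq, eval_eq_sum_range' hr, star_sum, Finset.sum_mul_sum, Finset.mul_sum]
    refine Finset.sum_congr rfl fun i _ => ?_
    rw [Finset.mul_sum]
    refine Finset.sum_congr rfl fun j _ => ?_
    rw [star_mul', ← fourier_natCast_eq_pow, ← fourier_natCast_eq_pow, star_fourier,
      sub_eq_add_neg, fourier_add, fourier_add]
    ring
  simp only [h]
  rw [MeasureTheory.integral_finsetSum _ fun a _ => circle_integrable (by fun_prop)]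
  refine Finset.sum_congr rfl fun i _ => ?_
  rw [MeasureTheory.integral_finsetSum _ fun a _ => circle_integrable (by fun_prop)]
  refine Finset.sum_congr rfl fun j _ => ?_
  rw [MeasureTheory.integral_const_mul, integral_fourier]

open Polynomial in
-- On the circle `q * star r` only has frequencies strictly between `-d` and `d`.
theorem integral_fourier_mul_polynomial_eq_zero {l : ℤ} {d : ℕ} {q r : ℂ[X]}
    (hq : q.natDegree < d) (hr : r.natDegree < d) (hl : (d : ℤ) ≤ |l|) :
    ∫ x : S1, fourier l x * (q.eval (fourier 1 x) * star (r.eval (fourier 1 x))) ∂haarS1 = 0 := by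
  rw [integral_fourier_mul_polynomial l hq hr]
  refine Finset.sum_eq_zero fun i hi => Finset.sum_eq_zero fun j hj => ?_
  rw [Finset.mem_range] at hi hj
  rw [if_neg, mul_zero]
  rcases le_abs.1 hl with h | h <;> omega

open Polynomial in
/-- Any squared modulus of a polynomial has the same low frequencies as the squared modulus of a
polynomial of large degree with all zeros on the circle. -/
theorem exists_polynomial_roots_on_circle {Q : ℂ[X]} (hQ : Q ≠ 0) {D N n : ℕ}
    (hD : Q.natDegree ≤ D) (hN : 0 < N) (hn : 2 * D + N + 1 ≤ n) :
    ∃ p : ℂ[X], p.natDegree = n - 1 ∧ (∀ z, p.IsRoot z → ‖z‖ = 1) ∧ ∀ k : ℤ, |k| < N →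
      ∫ x : S1, fourier k x * ((‖p.eval (fourier 1 x)‖ ^ 2 : ℝ) : ℂ) ∂haarS1 =
        ∫ x : S1, fourier k x * ((‖Q.eval (fourier 1 x)‖ ^ 2 : ℝ) : ℂ) ∂haarS1 := by
  set d := Q.natDegree with hd
  obtain ⟨q, r, hq, hr, hc, h1, h2, h3⟩ := exists_outer_polynomial d Q rfl hQ
  -- This shift gives total degree `n - 1`; moreover `κ ≥ d + N`, so the frequencies `k ± κ` exceed
  -- `d` in absolute value when `|k| < N`.
  set κ := n - 1 - d with hκ
  have hκ0 : 0 < κ := by omega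
  obtain ⟨h4, h5⟩ := natDegree_and_roots_of_self_inversive hκ0 hq hr hc h2 h3
  have hs : ((Real.sqrt 2)⁻¹ : ℂ) ≠ 0 := by simp
  refine ⟨C ((Real.sqrt 2)⁻¹ : ℂ) * (X ^ κ * q + r), ?_, fun z hz => h5 z ?_, fun k hk => ?_⟩
  · rw [natDegree_C_mul hs, h4]
    omega
  · rw [IsRoot, eval_mul, eval_C] at hz
    exact (mul_eq_zero.1 hz).resolve_left hs
  -- Expanding `|z^κ q + r|² / 2`: the two squares average to `|Q|²`, which explains the factor
  -- `1/√2`, and the cross terms carry `e_{±κ}`.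
  · have h6 : ∀ x : S1, fourier k x *
        ((‖(C ((Real.sqrt 2)⁻¹ : ℂ) * (X ^ κ * q + r)).eval (fourier 1 x)‖ ^ 2 : ℝ) : ℂ) =
        fourier k x * ((‖Q.eval (fourier 1 x)‖ ^ 2 : ℝ) : ℂ) +
        ((1 / 2) * (fourier (k + κ) x * (q.eval (fourier 1 x) * star (r.eval (fourier 1 x)))) +
        (1 / 2) * (fourier (k - κ) x * (r.eval (fourier 1 x) * star (q.eval (fourier 1 x))))) := by
      intro x
      obtain ⟨h7, h8⟩ := h1 (fourier 1 x) (norm_fourier_apply 1 x)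
      have h9 : (Q.eval (fourier 1 x) * star (Q.eval (fourier 1 x))) =
          q.eval (fourier 1 x) * star (q.eval (fourier 1 x)) := by
        rw [← starRingEnd_apply, ← starRingEnd_apply, Complex.mul_conj', Complex.mul_conj', h7]
      have h10 : (Q.eval (fourier 1 x) * star (Q.eval (fourier 1 x))) =
          r.eval (fourier 1 x) * star (r.eval (fourier 1 x)) := by
        rw [← starRingEnd_apply, ← starRingEnd_apply, Complex.mul_conj', Complex.mul_conj', h8]
      have h11 : (fourier (κ : ℤ) x : ℂ) * fourier (-κ) x = 1 := by
        rw [← fourier_add, add_neg_cancel, fourier_zero]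
      have h12 : ((Real.sqrt 2 : ℝ) : ℂ)⁻¹ * ((Real.sqrt 2 : ℝ) : ℂ)⁻¹ = 1 / 2 := by
        rw [← mul_inv, ← Complex.ofReal_mul, Real.mul_self_sqrt (by norm_num)]
        norm_num
      push_cast
      rw [← Complex.mul_conj', ← Complex.mul_conj', sub_eq_add_neg, fourier_add, fourier_add]
      simp only [eval_mul, eval_C, eval_add, eval_pow, eval_X, map_mul, map_add,
        ← fourier_natCast_eq_pow, starRingEnd_apply, star_fourier, star_inv₀]
      have h13 : star ((Real.sqrt 2 : ℝ) : ℂ) = (Real.sqrt 2 : ℝ) := Complex.conj_ofReal _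
      rw [h13]
      linear_combination (fourier k x * (fourier (κ : ℤ) x * q.eval (fourier 1 x) +
        r.eval (fourier 1 x)) * (fourier (-κ : ℤ) x * star (q.eval (fourier 1 x)) +
        star (r.eval (fourier 1 x)))) * h12 - (1 / 2) * fourier k x * h9
        - (1 / 2) * fourier k x * h10 +
        (1 / 2) * fourier k x * (q.eval (fourier 1 x) * star (q.eval (fourier 1 x))) * h11
    simp only [h6]
    have hk' := abs_lt.1 hk
    rw [MeasureTheory.integral_add (circle_integrable (by fun_prop))
      (circle_integrable (by fun_prop)), MeasureTheory.integral_add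
      (circle_integrable (by fun_prop)) (circle_integrable (by fun_prop)),
      MeasureTheory.integral_const_mul, MeasureTheory.integral_const_mul,
      integral_fourier_mul_polynomial_eq_zero (d := d + 1) (by omega) (by omega)
        (le_abs.2 (Or.inl (by omega))),
      integral_fourier_mul_polynomial_eq_zero (d := d + 1) (by omega) (by omega)
        (le_abs.2 (Or.inr (by omega)))]
    simp

open Polynomial in
/-- The normalised Dirichlet kernel of degree less than `N` centred at `y`. -/
noncomputable def dirichletPoly (N : ℕ) (y : S1) : ℂ[X] :=
  ∑ a ∈ Finset.range N, C ((Real.sqrt N : ℂ)⁻¹ * fourier (-(a : ℤ)) y) * X ^ a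

open Polynomial in
theorem dirichletPoly_natDegree_lt {N : ℕ} (hN : 0 < N) (y : S1) :
    (dirichletPoly N y).natDegree < N := by
  have : (dirichletPoly N y).natDegree ≤ N - 1 := by
    refine natDegree_sum_le_of_forall_le _ _ fun m hm => ?_
    rw [Finset.mem_range] at hm
    exact (natDegree_C_mul_X_pow_le _ _).trans (by omega)
  omega

open Polynomial in
theorem dirichletPoly_coeff {N : ℕ} (y : S1) {a : ℕ} (ha : a < N) :
    (dirichletPoly N y).coeff a = (Real.sqrt N : ℂ)⁻¹ * fourier (-(a : ℤ)) y := by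
  rw [dirichletPoly, finsetSum_coeff]
  simp only [coeff_C_mul_X_pow]
  rw [Finset.sum_ite_eq, if_pos (Finset.mem_range.2 ha)]

theorem integral_fourier_mul_dirichletPoly {N : ℕ} (hN : 0 < N) (y : S1) {k : ℤ}
    (hk : |k| < N) : ∫ x : S1, fourier k x * ((dirichletPoly N y).eval (fourier 1 x) *
      star ((dirichletPoly N y).eval (fourier 1 x))) ∂haarS1 =
      fourier k y * ((1 - |(k : ℝ)| / N : ℝ) : ℂ) := by
  have hd := dirichletPoly_natDegree_lt hN y
  have hk' := abs_lt.1 hk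
  rw [integral_fourier_mul_polynomial k hd hd]
  have h1 : ∀ i ∈ Finset.range N, ∀ j ∈ Finset.range N, (dirichletPoly N y).coeff i *
      star ((dirichletPoly N y).coeff j) * (if k + i - j = 0 then (1 : ℂ) else 0) =
      (fourier k y * (N : ℂ)⁻¹) * (if (j : ℤ) - i = k then (1 : ℂ) else 0) := by
    intro i hi j hj
    rw [Finset.mem_range] at hi hj
    rw [dirichletPoly_coeff y hi, dirichletPoly_coeff y hj]
    by_cases h : (j : ℤ) - i = k
    · rw [if_pos (by omega), if_pos h, ← h, sub_eq_add_neg, fourier_add, star_mul', star_inv₀,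
        star_fourier, neg_neg]
      have h13 : star ((Real.sqrt N : ℝ) : ℂ) = (Real.sqrt N : ℝ) := Complex.conj_ofReal _
      have h12 : ((Real.sqrt N : ℂ))⁻¹ * (Real.sqrt N : ℂ)⁻¹ = (N : ℂ)⁻¹ := by
        rw [← mul_inv, ← Complex.ofReal_mul, Real.mul_self_sqrt (by positivity)]
        norm_num
      rw [h13, ← h12]
      ring
    · rw [if_neg (by omega), if_neg h, mul_zero, mul_zero]
  rw [Finset.sum_congr rfl fun i hi => Finset.sum_congr rfl fun j hj => h1 i hi j hj]
  simp only [← Finset.mul_sum]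
  rw [Finset.sum_comm, sum_range_sub_eq, mul_assoc]
  congr 1
  rw [← Complex.ofReal_natCast (N - _), Nat.cast_sub (by omega), Nat.cast_natAbs]
  have : (N : ℂ) ≠ 0 := by exact_mod_cast hN.ne'
  push_cast
  field_simp

open Polynomial in
/-- Superposition of frequency-separated Dirichlet kernels with prescribed weights. -/
noncomputable def dirichletSum (N L : ℕ) (w : ℕ → ℝ) (y : ℕ → S1) : ℂ[X] :=
  ∑ j ∈ Finset.range L, C (Real.sqrt (w j) : ℂ) * (X ^ (2 * N * j) * dirichletPoly N (y j))

open Polynomial in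
theorem dirichletSum_natDegree_le {N : ℕ} (hN : 0 < N) (L : ℕ) (w : ℕ → ℝ) (y : ℕ → S1) :
    (dirichletSum N L w y).natDegree ≤ 2 * N * L := by
  refine natDegree_sum_le_of_forall_le _ _ fun j hj => ?_
  rw [Finset.mem_range] at hj
  refine (natDegree_C_mul_le _ _).trans (natDegree_mul_le.trans ?_)
  have h1 := dirichletPoly_natDegree_lt hN (y j)
  rw [natDegree_X_pow]
  have h2 : 2 * N * (j + 1) ≤ 2 * N * L := Nat.mul_le_mul_left _ hj
  have h3 : 2 * N * (j + 1) = 2 * N * j + 2 * N := by ring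
  omega

open Polynomial in
theorem integral_fourier_mul_dirichletSum {N : ℕ} (hN : 0 < N) (L : ℕ) {w : ℕ → ℝ} (y : ℕ → S1)
    (hw : ∀ j, 0 ≤ w j) {k : ℤ} (hk : |k| < N) :
    ∫ x : S1, fourier k x * ((‖(dirichletSum N L w y).eval (fourier 1 x)‖ ^ 2 : ℝ) : ℂ) ∂haarS1 =
      (∑ j ∈ Finset.range L, (w j : ℂ) * fourier k (y j)) * ((1 - |(k : ℝ)| / N : ℝ) : ℂ) := by
  have hcoe : ∀ j, star ((Real.sqrt (w j) : ℝ) : ℂ) = (Real.sqrt (w j) : ℝ) :=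
    fun j => Complex.conj_ofReal _
  have h : ∀ x : S1,
      fourier k x * ((‖(dirichletSum N L w y).eval (fourier 1 x)‖ ^ 2 : ℝ) : ℂ) =
      ∑ i ∈ Finset.range L, ∑ j ∈ Finset.range L,
        ((Real.sqrt (w i) : ℂ) * Real.sqrt (w j)) * (fourier (k + 2 * N * ((i : ℤ) - j)) x *
        ((dirichletPoly N (y i)).eval (fourier 1 x) *
          star ((dirichletPoly N (y j)).eval (fourier 1 x)))) := by
    intro x
    push_cast
    rw [← Complex.mul_conj', starRingEnd_apply, dirichletSum, eval_finsetSum, star_sum,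
      Finset.sum_mul_sum, Finset.mul_sum]
    refine Finset.sum_congr rfl fun i _ => ?_
    rw [Finset.mul_sum]
    refine Finset.sum_congr rfl fun j _ => ?_
    have h1 : k + 2 * N * ((i : ℤ) - j) = k + (2 * N * i : ℕ) + -(2 * N * j : ℕ) := by
      push_cast
      ring
    rw [h1, fourier_add, fourier_add]
    simp only [eval_mul, eval_C, eval_pow, eval_X, ← fourier_natCast_eq_pow, star_mul', hcoe,
      star_fourier]
    ring
  simp only [h]
  rw [MeasureTheory.integral_finsetSum _ fun a _ => circle_integrable (by fun_prop),
    Finset.sum_mul]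
  refine Finset.sum_congr rfl fun i hi => ?_
  rw [MeasureTheory.integral_finsetSum _ fun a _ => circle_integrable (by fun_prop),
    Finset.sum_eq_single i]
  · rw [MeasureTheory.integral_const_mul, sub_self, mul_zero, add_zero,
      integral_fourier_mul_dirichletPoly hN _ hk, ← Complex.ofReal_mul,
      Real.mul_self_sqrt (hw i), mul_assoc]
  -- Blocks are spaced by `2 * N`, so for `i ≠ j` the frequency `k + 2N(i - j)` is at least `N` in
  -- absolute value and the cross term integrates to zero.
  · intro j _ hj
    have hk' := abs_lt.1 hk
    rw [MeasureTheory.integral_const_mul, integral_fourier_mul_polynomial_eq_zero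
      (dirichletPoly_natDegree_lt hN _) (dirichletPoly_natDegree_lt hN _), mul_zero]
    have hN' : (0 : ℤ) < N := by exact_mod_cast hN
    rcases lt_or_gt_of_ne hj with h1 | h1
    · refine le_abs.2 (Or.inl ?_)
      have : 1 ≤ (i : ℤ) - j := by omega
      nlinarith
    · refine le_abs.2 (Or.inr ?_)
      have : (i : ℤ) - j ≤ -1 := by omega
      nlinarith
  · intro h'
    exact absurd hi h'

/-- Equidistributed points on the circle. -/
noncomputable def gridPoint (L j : ℕ) : S1 := ((2 * Real.pi * j / L : ℝ) : S1)

/-- A geometric sum over roots of unity; `|m| < L` rules out aliasing with the zero frequency. -/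
theorem sum_fourier_gridPoint {L : ℕ} {m : ℤ} (hm : |m| < L) :
    ∑ j ∈ Finset.range L, (fourier m (gridPoint L j) : ℂ) = if m = 0 then (L : ℂ) else 0 := by
  have hL : (L : ℂ) ≠ 0 := by
    have : 0 < (L : ℤ) := (abs_nonneg m).trans_lt hm
    have : L ≠ 0 := by omega
    exact_mod_cast this
  have hpi : (Real.pi : ℂ) ≠ 0 := by exact_mod_cast Real.pi_ne_zero
  split_ifs with h
  · simp [h]
  · set u := Complex.exp (2 * Real.pi * Complex.I * m / L) with hu
    have h1 : ∀ j : ℕ, (fourier m (gridPoint L j) : ℂ) = u ^ j := by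
      intro j
      rw [gridPoint, fourier_coe_apply, hu, ← Complex.exp_nat_mul]
      congr 1
      push_cast
      field_simp
    have h2 : u ^ L = 1 := by
      rw [hu, ← Complex.exp_nat_mul, Complex.exp_eq_one_iff]
      refine ⟨m, ?_⟩
      field_simp
    have h3 : u ≠ 1 := by
      intro h4
      rw [hu, Complex.exp_eq_one_iff] at h4
      obtain ⟨n, hn⟩ := h4
      have h5 : (m : ℂ) = n * L := by
        have hI := Complex.I_ne_zero
        field_simp at hn
        linear_combination hn
      have h6 : m = n * L := by exact_mod_cast h5
      rw [h6, abs_mul, Nat.abs_cast] at hm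
      have hn0 : n ≠ 0 := by
        rintro rfl
        exact h (by simpa using h6)
      have := Int.one_le_abs hn0
      nlinarith
    simp only [h1]
    rw [geom_sum_eq h3, h2]
    simp

/-- The translated Fejér kernels on a grid of `2 * N` points, normalised to sum to one. -/
noncomputable def fejerBump (N j : ℕ) : C(S1, ℂ) :=
  ∑ a ∈ Finset.range N, ∑ b ∈ Finset.range N,
    ((2 * (N : ℂ) ^ 2)⁻¹ * fourier ((b : ℤ) - a) (gridPoint (2 * N) j)) • fourier ((a : ℤ) - b)

theorem fejerBump_nonneg (N j : ℕ) (x : S1) : 0 ≤ fejerBump N j x := by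
  set y := gridPoint (2 * N) j
  have h : fejerBump N j x = (((2 * (N : ℝ) ^ 2)⁻¹ *
      ‖∑ a ∈ Finset.range N, (fourier (a : ℤ) x * fourier (-(a : ℤ)) y : ℂ)‖ ^ 2 : ℝ) : ℂ) := by
    push_cast
    rw [← Complex.mul_conj', map_sum, Finset.sum_mul_sum, Finset.mul_sum, fejerBump,
      ContinuousMap.sum_apply]
    refine Finset.sum_congr rfl fun a _ => ?_
    rw [ContinuousMap.sum_apply, Finset.mul_sum]
    refine Finset.sum_congr rfl fun b _ => ?_
    rw [ContinuousMap.smul_apply, sub_eq_add_neg, sub_eq_add_neg, fourier_add, fourier_add,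
      map_mul, starRingEnd_apply, starRingEnd_apply, star_fourier, star_fourier, neg_neg,
      smul_eq_mul]
    ring
  rw [h, Complex.zero_le_real]
  positivity

/-- The frequencies `k - (a - b)` are smaller than `2 * N` in absolute value, so summation over the
`2 * N` grid points is exact. It keeps only the diagonal `a - b = k`, with its `N - |k|` terms. -/
theorem sum_fejerBump_weights {N : ℕ} (ψ : C(S1, ℂ) →ₗ[ℂ] ℂ) {k : ℤ} (hk : |k| < N) :
    ∑ j ∈ Finset.range (2 * N), ψ (fejerBump N j) * fourier k (gridPoint (2 * N) j) =
      ((1 - |(k : ℝ)| / N : ℝ) : ℂ) * ψ (fourier k) := by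
  have hk' := abs_lt.1 hk
  have hN : (N : ℂ) ≠ 0 := by
    have : N ≠ 0 := by omega
    exact_mod_cast this
  have h1 : ∀ j, ψ (fejerBump N j) * fourier k (gridPoint (2 * N) j) =
      ∑ a ∈ Finset.range N, ∑ b ∈ Finset.range N, (2 * (N : ℂ) ^ 2)⁻¹ *
        ψ (fourier ((a : ℤ) - b)) * fourier (k - ((a : ℤ) - b)) (gridPoint (2 * N) j) := by
    intro j
    simp only [fejerBump, map_sum, map_smul, Finset.sum_mul]
    refine Finset.sum_congr rfl fun a _ => Finset.sum_congr rfl fun b _ => ?_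
    have : k - ((a : ℤ) - b) = ((b : ℤ) - a) + k := by ring
    rw [this, fourier_add, smul_eq_mul]
    ring
  simp only [h1]
  rw [Finset.sum_comm]
  have h2 : ∀ a ∈ Finset.range N, ∑ j ∈ Finset.range (2 * N), ∑ b ∈ Finset.range N,
      (2 * (N : ℂ) ^ 2)⁻¹ * ψ (fourier ((a : ℤ) - b)) *
        fourier (k - ((a : ℤ) - b)) (gridPoint (2 * N) j) =
      ∑ b ∈ Finset.range N, ((N : ℂ)⁻¹ * ψ (fourier k)) *
        (if (a : ℤ) - b = k then (1 : ℂ) else 0) := by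
    intro a ha
    rw [Finset.sum_comm]
    refine Finset.sum_congr rfl fun b hb => ?_
    rw [Finset.mem_range] at ha hb
    rw [← Finset.mul_sum,
      sum_fourier_gridPoint (abs_lt.2 ⟨by push_cast; omega, by push_cast; omega⟩)]
    by_cases h : (a : ℤ) - b = k
    · rw [if_pos (by omega), if_pos h, h]
      push_cast
      field_simp
    · rw [if_neg (by omega), if_neg h, mul_zero, mul_zero]
  rw [Finset.sum_congr rfl h2]
  simp only [← Finset.mul_sum]
  rw [sum_range_sub_eq, ← Complex.ofReal_natCast (N - _), Nat.cast_sub (by omega),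
    Nat.cast_natAbs]
  push_cast
  field_simp

/-- Every state of `C(S¹)` has, up to an explicit smoothing, the same low Fourier coefficients as
a pure state of the Toeplitz system. -/
theorem exists_extreme_state {ψ : C(S1, ℂ) →ₗ[ℂ] ℂ} (hψ : ψ ∈ circleStates) {N n : ℕ}
    (hN : 0 < N) (hn : 8 * N ^ 2 + N + 1 ≤ n) :
    ∃ φ ∈ Set.extremePoints ℝ (toeplitzStates n), ∀ k : ℤ, |k| < N →
      φ (circleCompression n (fourier k)) =
        (((1 - |(k : ℝ)| / N) ^ 2 : ℝ) : ℂ) * ψ (fourier k) := by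
  set w : ℕ → ℝ := fun j => (ψ (fejerBump N j)).re with hw
  have hw0 : ∀ j, 0 ≤ ψ (fejerBump N j) := fun j => hψ.1 _ (fejerBump_nonneg N j)
  have hwc : ∀ j, (w j : ℂ) = ψ (fejerBump N j) := fun j =>
    Complex.ext rfl (by simp [← (Complex.nonneg_iff.1 (hw0 j)).2])
  have hwr : ∀ j, 0 ≤ w j := fun j => (Complex.nonneg_iff.1 (hw0 j)).1
  -- The grid weights contribute one Fejér factor `1 - |k|/N` and the Dirichlet kernels placed at
  -- the grid points a second one, hence the square.
  set Q := dirichletSum N (2 * N) w (gridPoint (2 * N)) with hQ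
  have hQint : ∀ k : ℤ, |k| < N →
      ∫ x : S1, fourier k x * ((‖Q.eval (fourier 1 x)‖ ^ 2 : ℝ) : ℂ) ∂haarS1 =
        (((1 - |(k : ℝ)| / N) ^ 2 : ℝ) : ℂ) * ψ (fourier k) := by
    intro k hk
    rw [hQ, integral_fourier_mul_dirichletSum hN _ _ hwr hk]
    simp only [hwc]
    rw [sum_fejerBump_weights ψ hk]
    push_cast
    ring
  have hone : (fourier 0 : C(S1, ℂ)) = 1 := by
    ext x
    simp
  have hQ0 : Q ≠ 0 := by
    intro h
    have h1 := hQint 0 (by simpa using hN)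
    rw [h, hone, hψ.2] at h1
    simp at h1
  -- There are `2 * N` blocks of spacing `2 * N`, so the degree is at most `4 * N ^ 2`; this is the
  -- origin of `8 * N ^ 2 + N + 1`.
  obtain ⟨p, hp1, hp2, hp3⟩ := exists_polynomial_roots_on_circle (D := 4 * N ^ 2) (N := N)
    (n := n) hQ0 ((dirichletSum_natDegree_le hN _ _ _).trans (by nlinarith)) hN (by omega)
  have hn0 : 0 < n := by omega
  have hvec : ∀ k : ℤ, |k| < N →
      vectorFunctional (fun b : Fin n => p.coeff b) (circleCompression n (fourier k)) =
        (((1 - |(k : ℝ)| / N) ^ 2 : ℝ) : ℂ) * ψ (fourier k) := by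
    intro k hk
    rw [← hQint k hk, ← hp3 k hk]
    refine (quadForm_compression _ _).trans ?_
    refine MeasureTheory.integral_congr_ae (Filter.Eventually.of_forall fun x => ?_)
    have h1 : ∑ b : Fin n, p.coeff b * fourier (b : ℤ) x = p.eval (fourier 1 x) := by
      rw [Polynomial.eval_eq_sum_range, hp1, Nat.sub_add_cancel hn0, Finset.sum_range]
      simp only [fourier_natCast_eq_pow]
    simp only [h1]
  -- The frequency `k = 0` supplies the normalisation of `p`.
  refine ⟨_, vectorFunctional_mem_extremePoints hn0 hp1 hp2 ?_, hvec⟩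
  have h1 := hvec 0 (by simpa using hN)
  rw [hone, hψ.2, compression_one] at h1
  have h2 : vectorFunctional (fun b : Fin n => p.coeff b) ⟨1, one_mem_toeplitzSystem n⟩ =
      ((∑ b : Fin n, ‖p.coeff b‖ ^ 2 : ℝ) : ℂ) := by
    change star _ ⬝ᵥ (1 : Matrix (Fin n) (Fin n) ℂ).mulVec _ = _
    rw [Matrix.one_mulVec]
    simp [dotProduct, Complex.conj_mul']
  rw [h2] at h1
  have h3 : ((∑ b : Fin n, ‖p.coeff b‖ ^ 2 : ℝ) : ℂ) = ((1 : ℝ) : ℂ) := by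
    rw [h1]
    simp
  exact Complex.ofReal_injective h3

/-! ### Density of the pure states -/

/-- `min (1 / N) (1 / |k|)`, with value `0` at `k = 0`. -/
noncomputable def frequencyCutoff (N : ℕ) (k : ℤ) : ℝ := min (N : ℝ)⁻¹ |(k : ℝ)|⁻¹

theorem frequencyCutoff_nonneg (N : ℕ) (k : ℤ) : 0 ≤ frequencyCutoff N k :=
  le_min (by positivity) (by positivity)

theorem summable_abs_int_inv_sq : Summable fun k : ℤ => (|(k : ℝ)|⁻¹) ^ 2 := by
  have h := Real.summable_one_div_int_pow (p := 2)|>.2 one_lt_two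
  refine h.congr fun k => ?_
  rw [inv_pow, sq_abs, one_div]

theorem summable_frequencyCutoff_sq (N : ℕ) : Summable fun k => frequencyCutoff N k ^ 2 :=
  Summable.of_nonneg_of_le (fun _ => sq_nonneg _)
    (fun k => pow_le_pow_left₀ (frequencyCutoff_nonneg N k) (min_le_right _ _) 2)
    summable_abs_int_inv_sq

/-- Dominated convergence: each term is at most `1/N²`, and all are dominated by the summable
`1/k²`. -/
theorem tendsto_tsum_frequencyCutoff_sq :
    Filter.Tendsto (fun N : ℕ => ∑' k, frequencyCutoff N k ^ 2) Filter.atTop (nhds 0) := by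
  have h := tendsto_tsum_of_dominated_convergence (𝓕 := Filter.atTop)
    (f := fun (N : ℕ) (k : ℤ) => frequencyCutoff N k ^ 2) (g := fun _ => 0)
    summable_abs_int_inv_sq (fun k => ?_) (Filter.Eventually.of_forall fun N k => ?_)
  · simpa using h
  · have h1 : Filter.Tendsto (fun N : ℕ => ((N : ℝ)⁻¹) ^ 2) Filter.atTop (nhds 0) := by
      simpa using (tendsto_inv_atTop_nhds_zero_nat (𝕜 := ℝ)).pow 2
    exact squeeze_zero (fun _ => sq_nonneg _)
      (fun N => pow_le_pow_left₀ (frequencyCutoff_nonneg N k) (min_le_left _ _) 2) h1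
  · rw [Real.norm_of_nonneg (sq_nonneg _)]
    exact pow_le_pow_left₀ (frequencyCutoff_nonneg N k) (min_le_right _ _) 2

theorem summable_fourierCoeff_of_circleLipBall {f : C(S1, ℂ)} (hf : f ∈ circleLipBall) :
    Summable (fourierCoeff f) := by
  obtain ⟨A, -, hA⟩ := circleLipBall_fourierCoeff hf
  -- The weighted bound says nothing about the mean of `f`, so the majorant has a separate term at
  -- `k = 0`.
  refine Summable.of_norm_bounded ((hA.summable.add summable_abs_int_inv_sq).add
    (hasSum_ite_eq (0 : ℤ) ‖fourierCoeff f 0‖).summable) fun k => ?_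
  by_cases hk : k = 0
  · subst hk
    simp
  · rw [if_neg hk, add_zero]
    have h1 : 0 < |(k : ℝ)| := abs_pos.2 (by exact_mod_cast hk)
    have h2 : ‖fourierCoeff f k‖ = (|(k : ℝ)| * ‖fourierCoeff f k‖) * |(k : ℝ)|⁻¹ := by
      field_simp
    refine h2.le.trans ?_
    nlinarith [sq_nonneg (|(k : ℝ)| * ‖fourierCoeff f k‖ - |(k : ℝ)|⁻¹),
      sq_nonneg (|(k : ℝ)| * ‖fourierCoeff f k‖), sq_nonneg (|(k : ℝ)|⁻¹)]

theorem circleState_continuous {ψ : C(S1, ℂ) →ₗ[ℂ] ℂ} (hψ : ψ ∈ circleStates) : Continuous ψ :=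
  (LinearMap.mkContinuous ψ 2 fun f =>
    circleState_norm_le hψ f _ fun x => f.norm_coe_le_norm x).continuous

theorem circleState_fourier_norm_le {ψ : C(S1, ℂ) →ₗ[ℂ] ℂ} (hψ : ψ ∈ circleStates) (k : ℤ) :
    ‖ψ (fourier k)‖ ≤ 2 := by
  simpa using circleState_norm_le hψ (fourier k) 1 fun x => (norm_fourier_apply k x).le

/-- Below `N` the multiplier differs from `1` by at most `2|k|/N`; from `N` on, the trivial bound
`4` is used. The cutoff combines both cases in a form suited to Cauchy-Schwarz. -/
theorem norm_sub_fourier_le {χ ψ : C(S1, ℂ) →ₗ[ℂ] ℂ} (hχ : χ ∈ circleStates)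
    (hψ : ψ ∈ circleStates) {N : ℕ} (hN : 0 < N) (h : ∀ k : ℤ, |k| < N →
      χ (fourier k) = (((1 - |(k : ℝ)| / N) ^ 2 : ℝ) : ℂ) * ψ (fourier k)) (k : ℤ) :
    ‖χ (fourier k) - ψ (fourier k)‖ ≤ 4 * (|(k : ℝ)| * frequencyCutoff N k) := by
  have hψk := circleState_fourier_norm_le hψ k
  have hχk := circleState_fourier_norm_le hχ k
  have hN' : (0 : ℝ) < N := by exact_mod_cast hN
  rcases lt_or_ge |k| (N : ℤ) with hk | hk
  · have hkN : |(k : ℝ)| < N := by exact_mod_cast hk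
    set t := |(k : ℝ)| / N with ht
    have ht0 : 0 ≤ t := by positivity
    have ht1 : t ≤ 1 := (div_le_one hN').2 hkN.le
    have h1 : |(k : ℝ)| * frequencyCutoff N k = t := by
      rcases eq_or_ne k 0 with rfl | hk0
      · simp [ht]
      · have : 0 < |(k : ℝ)| := abs_pos.2 (by exact_mod_cast hk0)
        rw [frequencyCutoff, min_eq_left (inv_anti₀ this hkN.le), ht, div_eq_mul_inv]
    have h2 : χ (fourier k) - ψ (fourier k) =
        (((1 - t) ^ 2 - 1 : ℝ) : ℂ) * ψ (fourier k) := by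
      rw [h k hk, ← ht]
      push_cast
      ring
    have h3 : |(1 - t) ^ 2 - 1| ≤ 2 * t := abs_le.2 ⟨by nlinarith, by nlinarith⟩
    rw [h1, h2, norm_mul, Complex.norm_real, Real.norm_eq_abs]
    nlinarith [norm_nonneg (ψ (fourier k)), abs_nonneg ((1 - t) ^ 2 - 1)]
  · have hkN : (N : ℝ) ≤ |(k : ℝ)| := by exact_mod_cast hk
    rw [frequencyCutoff, min_eq_right (inv_anti₀ hN' hkN),
      mul_inv_cancel₀ (hN'.trans_le hkN).ne']
    refine (norm_sub_le _ _).trans ?_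
    linarith

/-- Expand `f` in its absolutely convergent Fourier series and pair the weighted coefficients `|k|
|f̂(k)|`, of square sum at most `1`, with the cutoffs. The bound does not depend on `f`. -/
theorem norm_sub_le_of_fourier {χ ψ : C(S1, ℂ) →ₗ[ℂ] ℂ} (hχ : χ ∈ circleStates)
    (hψ : ψ ∈ circleStates) {N : ℕ} (hN : 0 < N) (h : ∀ k : ℤ, |k| < N →
      χ (fourier k) = (((1 - |(k : ℝ)| / N) ^ 2 : ℝ) : ℂ) * ψ (fourier k)) {η : ℝ} (hη : 0 < η)
    {f : C(S1, ℂ)} (hf : f ∈ circleLipBall) :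
    ‖χ f - ψ f‖ ≤ 2 * η + 2 * η⁻¹ * ∑' k, frequencyCutoff N k ^ 2 := by
  obtain ⟨A, hA1, hA⟩ := circleLipBall_fourierCoeff hf
  have hsum := hasSum_fourier_series_of_summable (summable_fourierCoeff_of_circleLipBall hf)
  have h1 := hsum.map (χ - ψ) ((circleState_continuous hχ).sub (circleState_continuous hψ))
  have h2 : ∀ k : ℤ, ‖((χ - ψ) ∘ fun i => fourierCoeff f i • fourier i) k‖ ≤
      2 * η * (|(k : ℝ)| * ‖fourierCoeff f k‖) ^ 2 + 2 * η⁻¹ * frequencyCutoff N k ^ 2 := by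
    intro k
    have h3 : ((χ - ψ) ∘ fun i => fourierCoeff f i • fourier i) k =
        fourierCoeff f k * (χ (fourier k) - ψ (fourier k)) := by
      simp [mul_sub]
    rw [h3, norm_mul]
    set a := |(k : ℝ)| * ‖fourierCoeff f k‖ with ha
    set b := frequencyCutoff N k with hb
    have h4 : ‖fourierCoeff f k‖ * ‖χ (fourier k) - ψ (fourier k)‖ ≤ 4 * (a * b) := by
      have := mul_le_mul_of_nonneg_left (norm_sub_fourier_le hχ hψ hN h k)
        (norm_nonneg (fourierCoeff f k))
      refine this.trans (le_of_eq ?_)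
      rw [ha, hb]
      ring
    refine h4.trans ?_
    -- Weighted arithmetic-geometric mean inequality, used termwise in place of Cauchy-Schwarz for
    -- series.
    have h5 : 2 * η * a ^ 2 + 2 * η⁻¹ * b ^ 2 - 4 * (a * b) = 2 * η⁻¹ * (η * a - b) ^ 2 := by
      field_simp
      ring
    have h6 : 0 ≤ 2 * η⁻¹ * (η * a - b) ^ 2 := by positivity
    linarith
  have h3 := tsum_of_norm_bounded ((hA.mul_left (2 * η)).add
    ((summable_frequencyCutoff_sq N).hasSum.mul_left (2 * η⁻¹))) h2
  rw [h1.tsum_eq] at h3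
  refine h3.trans (add_le_add_left ?_ _)
  nlinarith

theorem circleStates_nonempty : circleStates.Nonempty :=
  ⟨{ toFun := fun f => f 0, map_add' := fun _ _ => rfl, map_smul' := fun _ _ => rfl },
    fun _ hf => hf 0, rfl⟩

/-- For large `n`, the pure states of the Toeplitz system are uniformly dense in the states of the
circle. -/
theorem exists_pureState_near {δ : ℝ} (hδ : 0 < δ) : ∃ n₀ : ℕ, ∀ n ≥ n₀, ∀ ψ : circleStates,
    ∃ φ : ToeplitzPureStates n, dist ψ (pullbackState φ.1) ≤ δ := by
  -- With `η = δ / 4` below, a tail under `δ ^ 2 / 16` makes both terms of the estimate at most `δ /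
  -- 2`.
  have hev := (tendsto_tsum_frequencyCutoff_sq.eventually (gt_mem_nhds
    (show (0 : ℝ) < δ ^ 2 / 16 by positivity))).and (Filter.eventually_gt_atTop 0)
  obtain ⟨N, hN1, hN⟩ := hev.exists
  refine ⟨8 * N ^ 2 + N + 1, fun n hn ψ => ?_⟩
  obtain ⟨φ, hφ, hφk⟩ := exists_extreme_state ψ.2 hN hn
  refine ⟨⟨⟨φ, hφ.1⟩, hφ⟩, ?_⟩
  rw [dist_comm]
  have h0C : (0 : C(S1, ℂ)) ∈ circleLipBall :=
    mem_circleLipBall_of_norm_le contDiff_const (by simp [circleDirac])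
  refine csSup_le ⟨_, 0, h0C, rfl⟩ ?_
  rintro _ ⟨f, hf, rfl⟩
  refine (norm_sub_le_of_fourier (pullbackState ⟨φ, hφ.1⟩).2 ψ.2 hN hφk
    (η := δ / 4) (by positivity) hf).trans ?_
  have h1 : 2 * (δ / 4)⁻¹ * ∑' k, frequencyCutoff N k ^ 2 ≤ 2 * (δ / 4)⁻¹ * (δ ^ 2 / 16) :=
    mul_le_mul_of_nonneg_left hN1.le (by positivity)
  have h2 : 2 * (δ / 4)⁻¹ * (δ ^ 2 / 16) = δ / 2 := by
    field_simp
    norm_num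
  linarith

/-! ### Convergence -/

theorem mainTheorem1 :
    Filter.Tendsto (fun n : ℕ => gromovHausdorffEDist (ToeplitzPureStates n) circleStates)
      Filter.atTop (nhds 0) := by
  rw [ENNReal.tendsto_nhds_zero]
  intro ε hε
  obtain ⟨e, -, he0, heε⟩ := ENNReal.lt_iff_exists_real_btwn.1 hε
  have he : 0 < e := by simpa using he0
  -- The budget `e` is split in half between the gluing distance and the density error; gluing at `e
  -- / 2` tolerates distortion `e`, so `4/√n < e` suffices.
  obtain ⟨n₀, hn₀⟩ := exists_pureState_near (half_pos he)
  have hs : Filter.Tendsto (fun n : ℕ => 4 * (Real.sqrt n)⁻¹) Filter.atTop (nhds 0) := by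
    simpa using ((Real.tendsto_sqrt_atTop.comp tendsto_natCast_atTop_atTop).inv_tendsto_atTop
      |>.const_mul (4 : ℝ))
  filter_upwards [Filter.eventually_ge_atTop n₀, Filter.eventually_gt_atTop 0,
    hs.eventually (gt_mem_nhds he)] with n hn hn0 hsn
  obtain ⟨ψ, hψ⟩ := circleStates_nonempty
  obtain ⟨φ, -⟩ := hn₀ n hn ⟨ψ, hψ⟩
  have : Nonempty (ToeplitzPureStates n) := ⟨φ⟩
  refine (gromovHausdorffEDist_le_of_approx (fun φ : ToeplitzPureStates n => pullbackState φ.1)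
    (half_pos he) (half_pos he).le (fun p q => ?_) (hn₀ n hn)).trans ?_
  · refine (abs_dist_sub_dist_pullbackState_le hn0 p.1 q.1).trans ?_
    linarith
  · rw [add_halves]
    exact heε.le
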